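/- **Timed Büchi automata and zone graphs.** A timed Büchi automaton (TBA) has a finite set $Q$ of states with an initial state $q_0$, a finite set $X$ of clocks, a set of accepting states, and finitely many transitions $(q,g,R,q')$, where the guard $g$ is a conjunction of constraints $x\,\#\,c$ with $x\in X$, $c\in\mathbb N$, $\#\in\{<,\le,=,\ge,>\}$, and $R\subseteq X$ is the set of clocks that are reset. A valuation is a function $v:X\to\mathbb R_{\ge 0}$. For a set $Z$ of valuations and a transition $t=(q,g,R,q')$ let $\mathrm{post}_t(Z)$ be the set of all $v'$ obtained from some $v\in Z$ by letting some time $\delta\ge 0$ elapse so that $v+\delta\models g$, and then setting the clocks in $R$ to $0$. The nodes of the zone graph $ZG(\mathcal A)$ are the pairs (state, zone) reachable from $(q_0,\{\mathbf 0\})$ by steps $(q,Z)\to(q',\mathrm{post}_t(Z))$ with $\mathrm{post}_t(Z)\neq\emptyset$. In $ZG^a(\mathcal A)$ the steps are $(q,Z)\to(q',\mathrm{Approx}_M(\mathrm{post}_t(Z)))$ instead, where $M$ is the largest constant in the guards of $\mathcal A$ and $\mathrm{Approx}_M(Z)$ is the smallest convex union of d-regions containing $Z$. Here $v,w$ are in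 the same d-region iff for all clocks $x,x'$: $v(x)>M\Leftrightarrow w(x)>M$; if $v(x)\le M$ then $\lfloor v(x)\rfloor=\lfloor w(x)\rfloor$ and ($v(x)\in\mathbb N\Leftrightarrow w(x)\in\mathbb N$); and $v(x)-v(x')\le c\Leftrightarrow w(x)-w(x')\le c$ for all integers $c$ with $-M<c<M$. **Strongly non-Zeno transformation.** $SNZ(\mathcal A)$ has one additional clock $z$. Every accepting state $q$ is replaced by two copies, $q_1$ (accepting) and $q_2$ (not accepting); the other states are kept. A transition of $\mathcal A$ from a non-accepting $p$ (from an accepting $p$: from $p_2$) into a non-accepting state is kept; one into an accepting state $q$ is replaced by the same transition into $q_2$ and by a transition into $q_1$ whose guard has the additional conjunct $z\ge 1$ and which also resets $z$. There is a transition without guard and reset from $q_1$ to $q_2$, for every accepting $q$. **The automata.** Let $n\ge 2$ and $d\ge 1$ be integers. $\mathcal A_n$ has clocks $x_1,\dots,x_n,y$ and is the chain $\mathcal R_n\to\mathcal V_n\to\mathcal R_{n-1}\to\mathcal V_{n-1}\to\dots\to\mathcal R_2\to\mathcal V_2$ of the following gadgets. * $\mathcal R_k$ has states $c^k_0,\dots,c^k_k,c^k_y$,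 an unguarded transition $c^k_j\to c^k_{j+1}$ resetting $x_{k-j}$ for $0\le j<k$, and an unguarded transition $c^k_k\to c^k_y$ resetting $y$. * $\mathcal V_k$ has states $b^k$ and $a^k$ ($a^k$ is accepting), a transition $b^k\to a^k$ with guard $y\le d$ and no reset, and an unguarded transition $a^k\to b^k$ resetting $x_1,\dots,x_{k-1}$. * The gadgets are linked by transitions $c^k_y\to b^k$ ($2\le k\le n$) and $b^{k+1}\to c^k_0$ ($2\le k<n$) without guard and reset. The initial state is $c^n_0$. Thus $\mathcal A_n$ has $n+1$ clocks and $\frac{(n-1)(n+10)}2$ states. Let $\mathcal B_n=SNZ(\mathcal A_n)$, with $n+2$ clocks. **Theorem (exponential blowup).** For all integers $n\ge 2$ and $d\ge 1$ the following holds, both for the zone graph $ZG$ and for $ZG^a$. 1. In the zone graph of $\mathcal A_n$ every state occurs with at least one and at most two zones, and each $b^k$ with exactly two. Hence there are only $O(n)$ nodes at the states of the gadgets $\mathcal V_k$ (at most $4(n-1)$), and the whole zone graph has at most twice as many nodes as $\mathcal A_n$ has states, that is at most $(n-1)(n+10)=O(n^2)$. 2. For $2\le k\le n$ the zone graph of $\mathcal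 B_n$ contains at least $(d+1)^{n-k+1}$ distinct zones at the state $b^k$. In particular it contains at least $(d+1)^{n-1}$ distinct zones, hence at least $(d+1)^{n-1}$ nodes, which is exponential in the number of clocks already for $d=1$. 3. If in the construction of $SNZ(\mathcal A_n)$ the guard $z\ge 1$ is replaced by $z\ge d$, the zone graph still contains at least $2^{n-k+1}$ distinct zones at the state $b^k$, for $2\le k\le n$; in particular it contains at least $2^{n-1}$ distinct zones and at least $2^{n-1}$ nodes. -/

import Mathlib

open scoped NNReal

/-! Timed Büchi automata, zone graphs, the strongly non-Zeno transformation and the gadgets. -/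

/-- Comparison symbols of clock constraints. -/
inductive Cmp
  | lt | le | eq | ge | gt

/-- Meaning of a comparison symbol. -/
def Cmp.Holds : Cmp → ℝ≥0 → ℝ≥0 → Prop
  | .lt, a, b => a < b
  | .le, a, b => a ≤ b
  | .eq, a, b => a = b
  | .ge, a, b => a ≥ b
  | .gt, a, b => a > b

/-- An atomic clock constraint `x # c` with `c` a natural number. -/
structure Atom (X : Type) where
  clock : X
  rel : Cmp
  const : ℕ

/-- Valuations of a set of clocks. -/
abbrev ClockVal (X : Type) := X → ℝ≥0

/-- Clock constraints (guards): finite conjunctions of atomic constraints. -/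
abbrev Guard (X : Type) := List (Atom X)

/-- `v` satisfies the guard `g`. -/
def Guard.Sat {X : Type} (g : Guard X) (v : ClockVal X) : Prop :=
  ∀ a ∈ g, a.rel.Holds (v a.clock) (a.const : ℝ≥0)

/-- Time elapse: `v + δ`. -/
def ClockVal.delay {X : Type} (v : ClockVal X) (δ : ℝ≥0) : ClockVal X := fun x => v x + δ

open Classical in
/-- Reset of the clocks in `R` to zero. -/
noncomputable def ClockVal.reset {X : Type} (R : Set X) (v : ClockVal X) : ClockVal X :=
  fun x => if x ∈ R then 0 else v x

/-- A transition `(q, g, R, q')`. -/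
structure Transition (Q X : Type) where
  src : Q
  guard : Guard X
  resets : Set X
  tgt : Q

/-- The timed step `(t.src, v) → (t.tgt, v')` along `t` with delay `δ`. -/
def Transition.Step {Q X : Type} (t : Transition Q X) (δ : ℝ≥0) (v v' : ClockVal X) : Prop :=
  t.guard.Sat (v.delay δ) ∧ v' = ClockVal.reset t.resets (v.delay δ)

/-- All valuations reached from a valuation in `S` by some delay followed by `t`. -/
def Transition.post {Q X : Type} (t : Transition Q X) (S : Set (ClockVal X)) :
    Set (ClockVal X) :=
  {v' | ∃ v ∈ S, ∃ δ : ℝ≥0, t.Step δ v v'}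

/-- Timed Büchi automata with finite sets `Q` of states and `X` of clocks. -/
structure TBA (Q X : Type) [Finite Q] [Finite X] where
  init : Q
  trans : Set (Transition Q X)
  trans_finite : trans.Finite
  acc : Set Q

/-- d-region equivalence with respect to the constant `M`. -/
structure DRegionEquiv {X : Type} (M : ℕ) (v w : ClockVal X) : Prop where
  above : ∀ x, (M : ℝ≥0) < v x ↔ (M : ℝ≥0) < w x
  floor : ∀ x, v x ≤ (M : ℝ≥0) → ⌊v x⌋₊ = ⌊w x⌋₊
  fract : ∀ x, v x ≤ (M : ℝ≥0) → (Int.fract (v x : ℝ) = 0 ↔ Int.fract (w x : ℝ) = 0)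
  diag : ∀ x y, ∀ c : ℤ, -(M : ℤ) < c → c < (M : ℤ) →
    ((v x : ℝ) - (v y : ℝ) ≤ (c : ℝ) ↔ (w x : ℝ) - (w y : ℝ) ≤ (c : ℝ))

/-- `S` is a union of d-regions, i.e. it is closed under d-region equivalence. -/
def IsUnionOfDRegions {X : Type} (M : ℕ) (S : Set (ClockVal X)) : Prop :=
  ∀ v w, DRegionEquiv M v w → v ∈ S → w ∈ S

/-- `Approx_M Z`: the smallest convex union of d-regions containing `Z`. -/
def approx {X : Type} (M : ℕ) (Z : Set (ClockVal X)) : Set (ClockVal X) :=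
  ⋂₀ {S | IsUnionOfDRegions M S ∧ Convex ℝ≥0 S ∧ Z ⊆ S}

/-- The two ways of building the zone graph: with the zones themselves (`exact`), or with
every zone replaced by its approximation `Approx_M` (`approx`). -/
inductive ZoneAbstraction
  | exact | approx

namespace TBA

variable {Q X : Type} [Finite Q] [Finite X]

/-- The largest constant in the guards of the automaton (`0` if there is none). -/
noncomputable def maxConst (A : TBA Q X) : ℕ :=
  sSup {c | ∃ t ∈ A.trans, ∃ a ∈ t.guard, a.const = c}

/-- The operator applied to the zone obtained after each transition. -/
def abstr (A : TBA Q X) : ZoneAbstraction → Set (ClockVal X) → Set (ClockVal X)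
  | .exact, Z => Z
  | .approx, Z => approx A.maxConst Z

/-- Nodes of the zone graph: pairs reachable from the initial node `(q₀, {0})` by symbolic
transitions that at least one valuation of the zone can take. -/
inductive IsZoneNode (A : TBA Q X) (σ : ZoneAbstraction) : Q → Set (ClockVal X) → Prop
  | init : IsZoneNode A σ A.init {fun _ => 0}
  | step (t : Transition Q X) (Z : Set (ClockVal X)) : t ∈ A.trans →
      IsZoneNode A σ t.src Z → (t.post Z).Nonempty →
      IsZoneNode A σ t.tgt (A.abstr σ (t.post Z))

/-- The set of nodes of the zone graph. -/
def zoneNodes (A : TBA Q X) (σ : ZoneAbstraction) : Set (Q × Set (ClockVal X)) :=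
  {p | A.IsZoneNode σ p.1 p.2}

/-- The zones that occur in the zone graph at the state `q`. -/
def zonesAt (A : TBA Q X) (σ : ZoneAbstraction) (q : Q) : Set (Set (ClockVal X)) :=
  {Z | A.IsZoneNode σ q Z}

/-- The zones that occur in the zone graph. -/
def zones (A : TBA Q X) (σ : ZoneAbstraction) : Set (Set (ClockVal X)) :=
  {Z | ∃ q, A.IsZoneNode σ q Z}

end TBA

/-! ### The strongly non-Zeno transformation

The new clock `z` is `none`. The states are `inl q` for the states `q` of `A` (for accepting `q`
this is the second, non-accepting copy) and `inr q`, the first, accepting copy of an accepting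
state `q`. -/

/-- A guard over the old clocks as a guard over the clocks extended by `z`. -/
def Guard.lift {X : Type} (g : Guard X) : Guard (Option X) :=
  g.map fun a => ⟨some a.clock, a.rel, a.const⟩

/-- A transition of the original automaton, kept as it is. -/
def snzKeep {Q X : Type} (acc : Set Q) (t : Transition Q X) :
    Transition (Q ⊕ acc) (Option X) :=
  ⟨.inl t.src, t.guard.lift, some '' t.resets, .inl t.tgt⟩

/-- The version of a transition `t` with accepting target `q` that enters the accepting copy of
`q`: it additionally checks `z ≥ N` and resets `z`. -/
def snzEnter {Q X : Type} (N : ℕ) (acc : Set Q) (t : Transition Q X) (q : acc) :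
    Transition (Q ⊕ acc) (Option X) :=
  ⟨.inl t.src, ⟨none, .ge, N⟩ :: t.guard.lift, insert none (some '' t.resets), .inr q⟩

/-- The transition from the accepting copy of an accepting state to the other copy. -/
def snzLeave {Q X : Type} (acc : Set Q) (q : acc) : Transition (Q ⊕ acc) (Option X) :=
  ⟨.inr q, [], ∅, .inl q.1⟩

/-- The strongly non-Zeno transformation with the guard `z ≥ N` on the new clock. -/
def snzWith {Q X : Type} [Finite Q] [Finite X] (N : ℕ) (A : TBA Q X) :
    TBA (Q ⊕ A.acc) (Option X) where
  init := .inl A.init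
  trans := snzKeep A.acc '' A.trans ∪
    {t' | ∃ t ∈ A.trans, ∃ q : A.acc, t.tgt = q ∧ t' = snzEnter N A.acc t q} ∪
    Set.range (snzLeave A.acc)
  trans_finite := by
    refine ((A.trans_finite.image _).union ?_).union (Set.finite_range _)
    refine ((A.trans_finite.prod (Set.finite_univ (α := A.acc))).image
      (fun p => snzEnter N A.acc p.1 p.2)).subset ?_
    rintro t' ⟨t, ht, q, -, rfl⟩
    exact ⟨(t, q), ⟨ht, trivial⟩, rfl⟩
  acc := Set.range .inr

/-- The strongly non-Zeno transformation `SNZ(A)`, with the guard `z ≥ 1`. -/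
abbrev snz {Q X : Type} [Finite Q] [Finite X] (A : TBA Q X) : TBA (Q ⊕ A.acc) (Option X) :=
  snzWith 1 A

/-! ### The gadgets and the automata -/

/-- The clocks `x_1, …, x_n` and `y`. -/
inductive Clk (n : ℕ)
  | x (i : Set.Icc 1 n)
  | y

/-- The states: `c^k_0, …, c^k_k` and `c^k_y` of the reset gadgets, and `a^k`, `b^k` of the loop
gadgets, for `2 ≤ k ≤ n`. -/
inductive Loc (n : ℕ)
  | c (k : Set.Icc 2 n) (j : Fin (k.1 + 1))
  | cy (k : Set.Icc 2 n)
  | a (k : Set.Icc 2 n)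
  | b (k : Set.Icc 2 n)

instance (n : ℕ) : Finite (Clk n) :=
  Finite.of_surjective
    (fun s : Set.Icc 1 n ⊕ Unit => match s with
      | .inl i => Clk.x i
      | .inr _ => Clk.y)
    (by
      rintro (i | _)
      · exact ⟨.inl i, rfl⟩
      · exact ⟨.inr (), rfl⟩)

instance (n : ℕ) : Finite (Loc n) :=
  Finite.of_surjective
    (fun s : (Σ k : Set.Icc 2 n, Fin (k.1 + 1)) ⊕ Set.Icc 2 n ⊕ Set.Icc 2 n ⊕ Set.Icc 2 n =>
      match s with
      | .inl p => Loc.c p.1 p.2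
      | .inr (.inl k) => Loc.cy k
      | .inr (.inr (.inl k)) => Loc.a k
      | .inr (.inr (.inr k)) => Loc.b k)
    (by
      rintro (⟨k, j⟩ | k | k | k)
      · exact ⟨.inl ⟨k, j⟩, rfl⟩
      · exact ⟨.inr (.inl k), rfl⟩
      · exact ⟨.inr (.inr (.inl k)), rfl⟩
      · exact ⟨.inr (.inr (.inr k)), rfl⟩)

/-- The gadget `R_k`: from `c^k_j` to `c^k_{j+1}` resetting `x_{k-j}` (for `0 ≤ j < k`), then from
`c^k_k` to `c^k_y` resetting `y`. -/
def gadgetR {n : ℕ} (k : Set.Icc 2 n) : Set (Transition (Loc n) (Clk n)) :=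
  Set.range (fun j : Fin k.1 =>
    ⟨.c k j.castSucc, [],
      {.x ⟨k.1 - j.1, by have := j.2; omega, (Nat.sub_le _ _).trans k.2.2⟩}, .c k j.succ⟩) ∪
  {⟨.c k (Fin.last k.1), [], {.y}, .cy k⟩}

/-- The gadget `V_k`: from `b^k` to `a^k` with guard `y ≤ d`, and back with reset of
`x_1, …, x_{k-1}`. -/
def gadgetV {n : ℕ} (d : ℕ) (k : Set.Icc 2 n) : Set (Transition (Loc n) (Clk n)) :=
  {⟨.b k, [⟨.y, .le, d⟩], ∅, .a k⟩, ⟨.a k, [], .x '' {i | i.1 < k.1}, .b k⟩}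

/-- The edge from the gadget `R_k` to the gadget `V_k`. -/
def edgeRV {n : ℕ} (k : Set.Icc 2 n) : Transition (Loc n) (Clk n) := ⟨.cy k, [], ∅, .b k⟩

/-- The edge from the gadget `V_{k+1}` to the gadget `R_k`, for `2 ≤ k < n`. -/
def edgeVR {n : ℕ} (k : Set.Ico 2 n) : Transition (Loc n) (Clk n) :=
  ⟨.b ⟨k.1 + 1, k.2.1.trans (Nat.le_succ _), k.2.2⟩, [], ∅, .c ⟨k.1, k.2.1, k.2.2.le⟩ 0⟩

/-- The automaton `A_n`: the chain `R_n → V_n → R_{n-1} → ⋯ → R_2 → V_2`. -/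
def autA (n d : ℕ) (hn : 2 ≤ n) : TBA (Loc n) (Clk n) where
  init := .c ⟨n, hn, le_rfl⟩ 0
  trans := (⋃ k, gadgetR k) ∪ (⋃ k, gadgetV d k) ∪ Set.range edgeRV ∪ Set.range edgeVR
  trans_finite := by
    refine (((Set.finite_iUnion fun k => ?_).union (Set.finite_iUnion fun k => ?_)).union
      (Set.finite_range _)).union (Set.finite_range _)
    · exact (Set.finite_range _).union (Set.finite_singleton _)
    · exact (Set.finite_singleton _).insert _
  acc := Set.range .a

/-- The automaton `B_n = SNZ(A_n)`. -/
abbrev autB (n d : ℕ) (hn : 2 ≤ n) : TBA (Loc n ⊕ (autA n d hn).acc) (Option (Clk n)) :=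
  snz (autA n d hn)

/-- The variant of `B_n` with the guard `z ≥ d` in place of `z ≥ 1`. -/
abbrev autBMax (n d : ℕ) (hn : 2 ≤ n) : TBA (Loc n ⊕ (autA n d hn).acc) (Option (Clk n)) :=
  snzWith d (autA n d hn)

/-! ### Abstraction operators -/

namespace TBA

variable {Q X : Type} [Finite Q] [Finite X]

/-! In `A_n`, up to the bound `y ≤ d` at `a^k`, a zone records only the order in which clocks were
last reset. It is an `orderZone`: a delay with resets raises the rank of each kept clock by one and
sends reset clocks to rank 0. The guard `y ≤ d` leaves no trace after the loop in `V_k`, because `y`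
is minimal among the clocks kept on the way back to `b^k`, so the elapsed time can be postponed past
the guard (`post_orderZone_inter_le`). What remains is whether `x_1, …, x_{k-1}` were reset after
`y`: two zones, and `R_k` erases even this (`post_resetY`). For `d ≥ 1` these zones are convex
unions of d-regions, so the approximation fixes them.

In `SNZ(A_n)` with guard `z ≥ N`, looping `f_k + 1` times through the accepting copy in `V_k` puts
at least `N * f_k` time units between the first and the last reset of `z`, hence `x_k - z ≥ N *
f_k`; any `f_k` with `N * f_k ≤ d` fits under `y ≤ d`. The next gadget resets `x_{k-1}`, and `z ≥ 0`
turns the bound into `x_k - x_{k-1} ≥ N * f_k`. Neither clock is reset afterwards, so the zone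
remembers every `f_j`. This gives `(d / N + 1) ^ (n - k + 1)` zones at `b^k`; the cases `N = 1` and
`N = d` are the two claims.

The zones of `SNZ(A_n)` are never computed. A node is kept `Enclosed`: lower bounds on differences
hold on all of its zone, and for each index some valuation in the zone makes that bound tight.
Approximation preserves both, since it only enlarges the zone and `diffZone` is itself a convex
union of d-regions. Testing the tight valuations of one choice against the bounds of another
separates the zones (`le_of_exitWitness`). -/

theorem subset_abstr (A : TBA Q X) (σ : ZoneAbstraction) (Z : Set (ClockVal X)) :
    Z ⊆ A.abstr σ Z := by
  cases σ with
  | exact => exact subset_rfl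
  | approx => exact Set.subset_sInter fun S hS => hS.2.2

theorem abstr_subset (A : TBA Q X) (σ : ZoneAbstraction) {Z U : Set (ClockVal X)}
    (hr : IsUnionOfDRegions A.maxConst U) (hc : Convex ℝ≥0 U) (h : Z ⊆ U) :
    A.abstr σ Z ⊆ U := by
  cases σ with
  | exact => exact h
  | approx => exact Set.sInter_subset_of_mem ⟨hr, hc, h⟩

theorem abstr_eq_self (A : TBA Q X) (σ : ZoneAbstraction) {Z : Set (ClockVal X)}
    (hr : IsUnionOfDRegions A.maxConst Z) (hc : Convex ℝ≥0 Z) : A.abstr σ Z = Z :=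
  (A.abstr_subset σ hr hc subset_rfl).antisymm (A.subset_abstr σ Z)

/-- The largest constant is `d` if all constants are at most `d` and `d` occurs. -/
theorem maxConst_eq (A : TBA Q X) {d : ℕ} (hle : ∀ t ∈ A.trans, ∀ a ∈ t.guard, a.const ≤ d)
    (hd : ∃ t ∈ A.trans, ∃ a ∈ t.guard, a.const = d) : A.maxConst = d := by
  have hb : ∀ c ∈ {c | ∃ t ∈ A.trans, ∃ a ∈ t.guard, a.const = c}, c ≤ d := by
    rintro c ⟨t, ht, a, ha, rfl⟩
    exact hle t ht a ha
  exact le_antisymm (csSup_le ⟨d, hd⟩ hb) (le_csSup ⟨d, hb⟩ hd)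

end TBA

section Zones

variable {X : Type}

/-! ### Zones given by a weak ordering of the clocks -/

/-- The valuations that are monotone in the rank of the clock and vanish at rank `0`. -/
def orderZone (r : X → ℕ) : Set (ClockVal X) :=
  {v | (∀ p q, r p ≤ r q → v p ≤ v q) ∧ ∀ p, r p = 0 → v p = 0}

theorem orderZone_congr {r s : X → ℕ} (h : ∀ p q, r p ≤ r q ↔ s p ≤ s q)
    (h0 : ∀ p, r p = 0 ↔ s p = 0) : orderZone r = orderZone s := by
  simp only [orderZone, h, h0]

theorem zero_mem_orderZone (r : X → ℕ) : (fun _ => 0) ∈ orderZone r :=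
  ⟨fun _ _ _ => le_rfl, fun _ _ => rfl⟩

theorem orderZone_zero : orderZone (fun _ : X => 0) = {fun _ => 0} := by
  ext v
  constructor
  · intro h
    exact funext fun p => h.2 p rfl
  · rintro rfl
    exact zero_mem_orderZone _

/-- The profile at `m` is the supremum of `v` over the clocks of rank at most `m`; an empty supremum
is 0 in `ℝ≥0`. A profile on `ℕ` makes delays and resets mere shifts of the index. -/
theorem mem_orderZone_iff [Finite X] {r : X → ℕ} {v : ClockVal X} :
    v ∈ orderZone r ↔ ∃ f : ℕ → ℝ≥0, Monotone f ∧ f 0 = 0 ∧ ∀ p, v p = f (r p) := by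
  constructor
  · rintro ⟨h, h0⟩
    have := Fintype.ofFinite X
    refine ⟨fun m => (Finset.univ.filter fun p => r p ≤ m).sup v, ?_, ?_, ?_⟩
    · intro m m' hm
      refine Finset.sup_mono fun p hp => ?_
      simp only [Finset.mem_filter, Finset.mem_univ, true_and] at hp ⊢
      exact hp.trans hm
    · refine le_antisymm (Finset.sup_le fun p hp => ?_) (zero_le)
      simp only [Finset.mem_filter, Finset.mem_univ, true_and, Nat.le_zero] at hp
      exact (h0 p hp).le
    · intro p
      refine le_antisymm (Finset.le_sup (by simp)) (Finset.sup_le fun q hq => ?_)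
      simp only [Finset.mem_filter, Finset.mem_univ, true_and] at hq
      exact h q p hq
  · rintro ⟨f, hf, hf0, h⟩
    exact ⟨fun p q hpq => by rw [h, h]; exact hf hpq, fun p hp => by rw [h, hp, hf0]⟩

theorem convex_orderZone (r : X → ℕ) : Convex ℝ≥0 (orderZone r) := by
  intro v hv w hw a b _ _ _
  refine ⟨fun p q hpq => ?_, fun p hp => ?_⟩
  · have h1 := hv.1 p q hpq
    have h2 := hw.1 p q hpq
    simp only [Pi.add_apply, Pi.smul_apply, smul_eq_mul]
    gcongr
  · simp [hv.2 p hp, hw.2 p hp]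

/-- This is the diagonal constraint with `c = 0`, available only when `-M < 0 < M`. -/
theorem DRegionEquiv.le_of_le {M : ℕ} {v w : ClockVal X} (h : DRegionEquiv M v w) (hM : 1 ≤ M)
    {p q : X} (hpq : v p ≤ v q) : w p ≤ w q := by
  have := h.diag p q 0 (by omega) (by omega)
  simpa [hpq] using this

theorem DRegionEquiv.eq_zero {M : ℕ} {v w : ClockVal X} (h : DRegionEquiv M v w)
    {p : X} (hp : v p = 0) : w p = 0 := by
  have h1 := h.floor p (by simp [hp])
  have h2 := (h.fract p (by simp [hp])).1 (by simp [hp])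
  rw [hp, Nat.floor_zero] at h1
  have h3 : w p < 1 := Nat.floor_eq_zero.1 h1.symm
  rw [Int.fract_eq_self.2 ⟨(w p).coe_nonneg, by exact_mod_cast h3⟩] at h2
  exact_mod_cast h2

theorem isUnionOfDRegions_orderZone {M : ℕ} (hM : 1 ≤ M) (r : X → ℕ) :
    IsUnionOfDRegions M (orderZone r) :=
  fun _ _ h hv => ⟨fun p q hpq => h.le_of_le hM (hv.1 p q hpq), fun p hp => h.eq_zero (hv.2 p hp)⟩

theorem isUnionOfDRegions_le (M : ℕ) (p : X) :
    IsUnionOfDRegions M {v : ClockVal X | v p ≤ (M : ℝ≥0)} := by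
  intro v w h hv
  have := h.above p
  simp only [Set.mem_ofPred_eq] at hv ⊢
  rw [← not_lt] at hv ⊢
  rwa [← this]

theorem convex_le_const (c : ℝ≥0) (p : X) : Convex ℝ≥0 {v : ClockVal X | v p ≤ c} := by
  intro v hv w hw a b _ _ hab
  simp only [Set.mem_ofPred_eq] at hv hw ⊢
  calc a * v p + b * w p ≤ a * c + b * c := by gcongr
    _ = c := by rw [← add_mul, hab, one_mul]

theorem IsUnionOfDRegions.inter {M : ℕ} {S T : Set (ClockVal X)} (hS : IsUnionOfDRegions M S)
    (hT : IsUnionOfDRegions M T) : IsUnionOfDRegions M (S ∩ T) :=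
  fun v w h hv => ⟨hS v w h hv.1, hT v w h hv.2⟩

open Classical in
/-- The ranks after some time has elapsed and the clocks in `R` have been reset. -/
noncomputable def resetRank (R : Set X) (r : X → ℕ) : X → ℕ := fun p => if p ∈ R then 0 else r p + 1

theorem Guard.sat_nil (v : ClockVal X) : Guard.Sat [] v := by
  intro a ha
  cases ha

theorem Guard.sat_cons {a : Atom X} {g : Guard X} {v : ClockVal X} :
    Guard.Sat (a :: g) v ↔ a.rel.Holds (v a.clock) a.const ∧ Guard.Sat g v := by
  simp [Guard.Sat]

theorem Guard.sat_lift {g : Guard X} {v : ClockVal (Option X)} :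
    g.lift.Sat v ↔ g.Sat fun p => v (some p) := by
  simp [Guard.Sat, Guard.lift]

theorem ClockVal.reset_empty (v : ClockVal X) : v.reset ∅ = v := by
  ext p
  simp [ClockVal.reset]

theorem ClockVal.reset_of_mem {R : Set X} {p : X} (v : ClockVal X) (h : p ∈ R) :
    v.reset R p = 0 := by simp [ClockVal.reset, h]

theorem ClockVal.reset_of_notMem {R : Set X} {p : X} (v : ClockVal X) (h : p ∉ R) :
    v.reset R p = v p := by simp [ClockVal.reset, h]

theorem reset_delay_mem_orderZone [Finite X] {r : X → ℕ} {v : ClockVal X} (hv : v ∈ orderZone r)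
    (R : Set X) (δ : ℝ≥0) : (v.delay δ).reset R ∈ orderZone (resetRank R r) := by
  obtain ⟨f, hf, hf0, h⟩ := mem_orderZone_iff.1 hv
  refine mem_orderZone_iff.2 ⟨fun m => m.casesOn 0 fun m => f m + δ, ?_, rfl, fun p => ?_⟩
  · refine monotone_nat_of_le_succ fun m => ?_
    cases m with
    | zero => exact zero_le
    | succ m => exact add_le_add_left (hf m.le_succ) δ
  · by_cases hp : p ∈ R
    · simp [ClockVal.reset, resetRank, hp]
    · simp [ClockVal.reset, resetRank, ClockVal.delay, hp, h]

/-- Every valuation of the zone after the transition is reached from a valuation in which all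
clocks of rank at most `m` vanish, if all clocks that are not reset have rank at least `m`. -/
theorem exists_of_mem_orderZone_resetRank [Finite X] {r : X → ℕ} {R : Set X} {w : ClockVal X}
    (hw : w ∈ orderZone (resetRank R r)) (m : ℕ) (hm : ∀ p ∉ R, m ≤ r p) :
    ∃ v ∈ orderZone r, (∀ p, r p ≤ m → v p = 0) ∧ ∃ δ, w = (v.delay δ).reset R := by
  obtain ⟨f, hf, hf0, h⟩ := mem_orderZone_iff.1 hw
  -- The delay is `f (m + 1)`. Truncated subtraction makes every clock of rank at most `m` start at
  -- 0; a clock of rank below `m` may thereby get a wrong value after the delay, but such a clock is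
  -- reset.
  refine ⟨fun p => f (r p + 1) - f (m + 1), mem_orderZone_iff.2
    ⟨fun i => f (i + 1) - f (m + 1), fun i j hij => ?_, ?_, fun _ => rfl⟩, fun p hp => ?_,
    f (m + 1), funext fun p => ?_⟩
  · exact tsub_le_tsub_right (hf (by omega)) _
  · exact tsub_eq_zero_of_le (hf (by omega))
  · exact tsub_eq_zero_of_le (hf (by omega))
  · by_cases hp : p ∈ R
    · simp [ClockVal.reset, h, resetRank, hp, hf0]
    · have : f (m + 1) ≤ f (r p + 1) := hf (by have := hm p hp; omega)
      simp [ClockVal.reset, ClockVal.delay, h, resetRank, hp, tsub_add_cancel_of_le this]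

variable {Q : Type}

/-- The zone after a transition without guard. -/
theorem post_orderZone [Finite X] (R : Set X) (q q' : Q) (r : X → ℕ) :
    (⟨q, [], R, q'⟩ : Transition Q X).post (orderZone r) = orderZone (resetRank R r) := by
  ext w
  constructor
  · rintro ⟨v, hv, δ, -, rfl⟩
    exact reset_delay_mem_orderZone hv R δ
  · intro hw
    obtain ⟨v, hv, -, δ, rfl⟩ := exists_of_mem_orderZone_resetRank hw 0 fun _ _ => Nat.zero_le _
    exact ⟨v, hv, δ, Guard.sat_nil _, rfl⟩

/-- The zone after a transition with an upper bound on one clock and no reset. -/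
theorem post_orderZone_le [Finite X] (y : X) (d : ℕ) (q q' : Q) (r : X → ℕ) :
    (⟨q, [⟨y, .le, d⟩], ∅, q'⟩ : Transition Q X).post (orderZone r) =
      orderZone (resetRank ∅ r) ∩ {v | v y ≤ (d : ℝ≥0)} := by
  ext w
  constructor
  · rintro ⟨v, hv, δ, hg, rfl⟩
    refine ⟨reset_delay_mem_orderZone hv ∅ δ, ?_⟩
    rw [ClockVal.reset_empty]
    exact (Guard.sat_cons.1 hg).1
  · rintro ⟨hw, hy⟩
    obtain ⟨v, hv, -, δ, rfl⟩ := exists_of_mem_orderZone_resetRank hw 0 fun _ _ => Nat.zero_le _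
    refine ⟨v, hv, δ, Guard.sat_cons.2 ⟨?_, Guard.sat_nil _⟩, rfl⟩
    rw [ClockVal.reset_empty] at hy
    exact hy

/-- An upper bound on a clock `y` is forgotten by the next transition without guard if no clock
below `y` is kept. -/
theorem post_orderZone_inter_le [Finite X] (R : Set X) (y : X) (c : ℝ≥0) (q q' : Q) (r : X → ℕ)
    (h : ∀ p ∉ R, r y ≤ r p) :
    (⟨q, [], R, q'⟩ : Transition Q X).post (orderZone r ∩ {v | v y ≤ c}) =
      orderZone (resetRank R r) := by
  ext w
  constructor
  · rintro ⟨v, hv, δ, -, rfl⟩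
    exact reset_delay_mem_orderZone hv.1 R δ
  · intro hw
    obtain ⟨v, hv, hv0, δ, rfl⟩ := exists_of_mem_orderZone_resetRank hw (r y) h
    exact ⟨v, ⟨hv, by simp [hv0 y le_rfl]⟩, δ, Guard.sat_nil _, rfl⟩

/-! ### Zones given by lower bounds on clock differences -/

/-- A lower bound `c` on `a - b` with `c ≤ d`, relaxed to `a - b > d - 1` for `c = d`, so that it
is invariant under d-region equivalence for the constant `d`. -/
def DiffBound (d c : ℕ) (a b : ℝ≥0) : Prop := if c < d then c + b ≤ a else d + b < a + 1

theorem diffBound_of_add_le {d c : ℕ} {a b : ℝ≥0} (hc : c ≤ d) (h : c + b ≤ a) :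
    DiffBound d c a b := by
  unfold DiffBound
  split_ifs with h1
  · exact h
  · obtain rfl : c = d := by omega
    exact h.trans_lt (by simp)

theorem DiffBound.mono {d c : ℕ} {a b b' : ℝ≥0} (h : DiffBound d c a b) (hb : b' ≤ b) :
    DiffBound d c a b' := by
  unfold DiffBound at *
  split_ifs at * with h1
  · exact (by gcongr : _ ≤ (c : ℝ≥0) + b).trans h
  · exact (by gcongr : _ ≤ (d : ℝ≥0) + b).trans_lt h

theorem DiffBound.delay {d c : ℕ} {a b : ℝ≥0} (h : DiffBound d c a b) (δ : ℝ≥0) :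
    DiffBound d c (a + δ) (b + δ) := by
  unfold DiffBound at *
  split_ifs at * with h1
  · rw [← add_assoc]; gcongr
  · rw [← add_assoc, add_right_comm a]
    exact add_lt_add_left h δ

theorem DiffBound.le_of_nat {d c a : ℕ} {b : ℝ≥0} (hc : c ≤ d)
    (h : DiffBound d c (b + a) b) : c ≤ a := by
  unfold DiffBound at h
  rw [add_comm b] at h
  split_ifs at h with h1
  · exact_mod_cast (add_le_add_iff_right b).1 h
  · rw [add_right_comm] at h
    have : (d : ℝ≥0) < ((a + 1 : ℕ) : ℝ≥0) := by
      push_cast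
      exact (add_lt_add_iff_right b).1 h
    have := Nat.cast_lt.1 this
    omega

/-- The valuations that satisfy the bound `c` on `p - q` whenever `C p q c`. -/
def diffZone (d : ℕ) (C : X → X → ℕ → Prop) : Set (ClockVal X) :=
  {v | ∀ p q c, C p q c → DiffBound d c (v p) (v q)}

theorem convex_diffZone (d : ℕ) (C : X → X → ℕ → Prop) : Convex ℝ≥0 (diffZone d C) := by
  intro v hv w hw a b _ _ hab p q c hC
  have h1 := hv p q c hC
  have h2 := hw p q c hC
  simp only [DiffBound, Pi.add_apply, Pi.smul_apply, smul_eq_mul] at h1 h2 ⊢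
  split_ifs at * with h
  · calc (c : ℝ≥0) + (a * v q + b * w q) = (a + b) * c + (a * v q + b * w q) := by
          rw [hab, one_mul]
      _ = a * (c + v q) + b * (c + w q) := by ring
      _ ≤ a * v p + b * w p := by gcongr
  · have e1 : (d : ℝ≥0) + (a * v q + b * w q) = a * (d + v q) + b * (d + w q) := by
      calc _ = (a + b) * (d : ℝ≥0) + (a * v q + b * w q) := by rw [hab, one_mul]
        _ = _ := by ring
    have e2 : a * v p + b * w p + 1 = a * (v p + 1) + b * (w p + 1) := by
      calc _ = a * v p + b * w p + (a + b) := by rw [hab]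
        _ = _ := by ring
    rw [e1, e2]
    -- A strict bound survives a convex combination through a term with nonzero weight; if `a = 0`,
    -- all the weight is on `w`.
    rcases eq_or_ne a 0 with rfl | ha
    · obtain rfl : b = 1 := by simpa using hab
      simpa using h2
    · exact add_lt_add_of_lt_of_le (mul_lt_mul_of_pos_left h1 (pos_iff_ne_zero.2 ha))
        (mul_le_mul_right h2.le b)

theorem isUnionOfDRegions_diffZone {d : ℕ} (hd : 1 ≤ d) (C : X → X → ℕ → Prop) :
    IsUnionOfDRegions d (diffZone d C) := by
  intro v w h hv p q c hC
  have h1 := hv p q c hC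
  simp only [DiffBound] at h1 ⊢
  split_ifs at * with hc
  · have := h.diag q p (-c) (by omega) (by omega)
    rw [← NNReal.coe_le_coe] at h1 ⊢
    push_cast at *
    have := this.1 (by linarith)
    linarith
  · have := h.diag p q (d - 1) (by omega) (by omega)
    rw [← NNReal.coe_lt_coe] at h1 ⊢
    push_cast at *
    by_contra hcon
    have := this.2 (by linarith)
    linarith

/-- The difference constraints that hold after a transition: a constraint survives if its first
clock is kept; the second clock may be reset; and if the second clock `q` is reset under the guard
`q ≥ N` then the bound increases by `N`. -/
theorem post_diffZone_subset {d N : ℕ} {t : Transition Q X} {C C' : X → X → ℕ → Prop}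
    (h : ∀ p q c, C' p q c → p ∉ t.resets ∧ (C p q c ∨ q ∈ t.resets ∧
      (c = 0 ∨ (∃ q', C p q' c) ∨
        ∃ c', C p q c' ∧ c = c' + N ∧ c' < d ∧ c ≤ d ∧ ⟨q, .ge, N⟩ ∈ t.guard))) :
    t.post (diffZone d C) ⊆ diffZone d C' := by
  rintro _ ⟨v, hv, δ, ⟨hg, rfl⟩⟩ p q c hC
  obtain ⟨hp, hq⟩ := h p q c hC
  rw [ClockVal.reset_of_notMem _ hp]
  have key : ∀ q', C p q' c → DiffBound d c (v.delay δ p) (v.delay δ q') :=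
    fun q' hq' => (hv p q' c hq').delay δ
  rcases hq with hq | ⟨hqR, hq⟩
  · refine (key q hq).mono ?_
    by_cases hqR : q ∈ t.resets
    · rw [ClockVal.reset_of_mem _ hqR]
      exact zero_le
    · rw [ClockVal.reset_of_notMem _ hqR]
  · rw [ClockVal.reset_of_mem _ hqR]
    rcases hq with rfl | ⟨q', hq'⟩ | ⟨c', hc', rfl, hlt, hle, hmem⟩
    · exact diffBound_of_add_le (Nat.zero_le _) (by simp)
    · exact (key q' hq').mono zero_le
    · refine diffBound_of_add_le hle ?_
      have h1 := (hv p q c' hc').delay δ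
      rw [DiffBound, if_pos hlt] at h1
      have h2 : (N : ℝ≥0) ≤ v.delay δ q := hg _ hmem
      push_cast
      rw [add_zero]
      exact (add_le_add_right h2 _).trans h1

end Zones

/-! ### Nodes that are enclosed between witnesses and an upper bound -/

namespace TBA

variable {Q X : Type} [Finite Q] [Finite X] {ι : Type}

/-- There is a node at `q` whose zone is contained in `U` and meets every `T j`. -/
def Enclosed (A : TBA Q X) (σ : ZoneAbstraction) (q : Q) (T : ι → ClockVal X → Prop)
    (U : Set (ClockVal X)) : Prop :=
  ∃ Z, A.IsZoneNode σ q Z ∧ Z ⊆ U ∧ ∀ j, ∃ v ∈ Z, T j v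

/-- Witnesses survive because abstraction only enlarges a zone, and the upper bound survives because
`U'` competes in the intersection defining the approximation. A nonempty index type supplies the
valuation that makes the symbolic step legal. -/
theorem Enclosed.step [Nonempty ι] {A : TBA Q X} {σ : ZoneAbstraction} {t : Transition Q X}
    {T T' : ι → ClockVal X → Prop} {U U' : Set (ClockVal X)} (h : A.Enclosed σ t.src T U)
    (ht : t ∈ A.trans)
    (hT : ∀ j v, T j v → ∃ δ, t.guard.Sat (v.delay δ) ∧ T' j ((v.delay δ).reset t.resets))
    (hU : t.post U ⊆ U') (hr : IsUnionOfDRegions A.maxConst U') (hc : Convex ℝ≥0 U') :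
    A.Enclosed σ t.tgt T' U' := by
  obtain ⟨Z, hZ, hZU, hZT⟩ := h
  have key : ∀ j, ∃ v' ∈ t.post Z, T' j v' := by
    intro j
    obtain ⟨v, hv, hTv⟩ := hZT j
    obtain ⟨δ, hg, hT'⟩ := hT j v hTv
    exact ⟨_, ⟨v, hv, δ, hg, rfl⟩, hT'⟩
  refine ⟨_, .step t Z ht hZ ?_, A.abstr_subset σ hr hc ?_, fun j => ?_⟩
  · obtain ⟨v', hv', -⟩ := key (Classical.arbitrary ι)
    exact ⟨v', hv'⟩
  · refine Set.Subset.trans ?_ hU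
    rintro _ ⟨v, hv, δ, hs⟩
    exact ⟨v, hZU hv, δ, hs⟩
  · obtain ⟨v', hv', hT'⟩ := key j
    exact ⟨v', A.subset_abstr σ _ hv', hT'⟩

end TBA

/-! ### The automaton `A_n` -/

section AutA

variable {n : ℕ}

/-! ### Numbers of clocks and states -/

theorem card_clk (n : ℕ) : Nat.card (Clk n) = n + 1 := by
  have e : Clk n ≃ Option (Set.Icc 1 n) :=
    { toFun := fun
        | .x i => some i
        | .y => none
      invFun := fun
        | some i => .x i
        | none => .y
      left_inv := by rintro (_ | _) <;> rfl
      right_inv := by rintro (_ | _) <;> rfl }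
  rw [Nat.card_congr e, Finite.card_option]
  simp

/-- Twice the state count: gadget `k` has `k + 1` states `c^k_j`, and the states `c^k_y`, `a^k`,
`b^k` contribute `3 * (n - 1)` in all. -/
theorem sum_Icc_two_succ (n : ℕ) (hn : 2 ≤ n) :
    2 * ∑ k ∈ Finset.Icc 2 n, (k + 1) + 6 * (n - 1) = (n - 1) * (n + 10) := by
  induction n, hn using Nat.le_induction with
  | base => rfl
  | succ n hn ih =>
    obtain ⟨m, rfl⟩ := Nat.exists_eq_add_of_le' hn
    rw [Finset.sum_Icc_succ_top (by omega)]
    simp only [Nat.add_sub_cancel, show m + 2 - 1 = m + 1 by omega] at ih ⊢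
    nlinarith

theorem card_loc (n : ℕ) (hn : 2 ≤ n) : 2 * Nat.card (Loc n) = (n - 1) * (n + 10) := by
  have e : Loc n ≃ (Σ k : Set.Icc 2 n, Fin (k.1 + 1)) ⊕ Set.Icc 2 n ⊕ Set.Icc 2 n ⊕ Set.Icc 2 n :=
    { toFun := fun
        | .c k j => .inl ⟨k, j⟩
        | .cy k => .inr (.inl k)
        | .a k => .inr (.inr (.inl k))
        | .b k => .inr (.inr (.inr k))
      invFun := fun
        | .inl p => .c p.1 p.2
        | .inr (.inl k) => .cy k
        | .inr (.inr (.inl k)) => .a k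
        | .inr (.inr (.inr k)) => .b k
      left_inv := by rintro (_ | _ | _ | _) <;> rfl
      right_inv := by rintro (_ | _ | _ | _) <;> rfl }
  rw [Nat.card_congr e, ← sum_Icc_two_succ n hn]
  have h : ∑ k ∈ Finset.Icc 2 n, (k + 1) = ∑ k : Set.Icc 2 n, (k.1 + 1) :=
    Finset.sum_subtype (Finset.Icc 2 n) (p := fun k => k ∈ Set.Icc 2 n) (by simp) _
  rw [h, Nat.card_sum, Nat.card_sum, Nat.card_sum, Nat.card_sigma]
  simp
  omega

/-! ### Transitions and largest constant of `A_n` -/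

theorem mem_trans_reset (d : ℕ) (hn : 2 ≤ n) (k : Set.Icc 2 n) (j : Fin k.1) :
    ⟨.c k j.castSucc, [],
      {.x ⟨k.1 - j.1, by have := j.2; omega, (Nat.sub_le _ _).trans k.2.2⟩}, .c k j.succ⟩ ∈
      (autA n d hn).trans :=
  .inl (.inl (.inl (Set.mem_iUnion.2 ⟨k, .inl ⟨j, rfl⟩⟩)))

theorem mem_trans_resetY (d : ℕ) (hn : 2 ≤ n) (k : Set.Icc 2 n) :
    ⟨.c k (Fin.last k.1), [], {.y}, .cy k⟩ ∈ (autA n d hn).trans :=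
  .inl (.inl (.inl (Set.mem_iUnion.2 ⟨k, .inr rfl⟩)))

theorem mem_trans_enter (d : ℕ) (hn : 2 ≤ n) (k : Set.Icc 2 n) :
    ⟨.b k, [⟨.y, .le, d⟩], ∅, .a k⟩ ∈ (autA n d hn).trans :=
  .inl (.inl (.inr (Set.mem_iUnion.2 ⟨k, .inl rfl⟩)))

theorem mem_trans_back (d : ℕ) (hn : 2 ≤ n) (k : Set.Icc 2 n) :
    ⟨.a k, [], .x '' {i | i.1 < k.1}, .b k⟩ ∈ (autA n d hn).trans :=
  .inl (.inl (.inr (Set.mem_iUnion.2 ⟨k, .inr rfl⟩)))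

theorem mem_trans_edgeRV (d : ℕ) (hn : 2 ≤ n) (k : Set.Icc 2 n) :
    edgeRV k ∈ (autA n d hn).trans :=
  .inl (.inr ⟨k, rfl⟩)

theorem mem_trans_edgeVR (d : ℕ) (hn : 2 ≤ n) (k : Set.Ico 2 n) :
    edgeVR k ∈ (autA n d hn).trans :=
  .inr ⟨k, rfl⟩

/-- Case distinction over the transitions of `A_n`. -/
theorem forall_mem_trans {d : ℕ} {hn : 2 ≤ n} {P : Transition (Loc n) (Clk n) → Prop}
    (h1 : ∀ (k : Set.Icc 2 n) (j : Fin k.1), P ⟨.c k j.castSucc, [],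
      {.x ⟨k.1 - j.1, by have := j.2; omega, (Nat.sub_le _ _).trans k.2.2⟩}, .c k j.succ⟩)
    (h2 : ∀ k : Set.Icc 2 n, P ⟨.c k (Fin.last k.1), [], {.y}, .cy k⟩)
    (h3 : ∀ k : Set.Icc 2 n, P ⟨.b k, [⟨.y, .le, d⟩], ∅, .a k⟩)
    (h4 : ∀ k : Set.Icc 2 n, P ⟨.a k, [], .x '' {i | i.1 < k.1}, .b k⟩)
    (h5 : ∀ k : Set.Icc 2 n, P (edgeRV k)) (h6 : ∀ k : Set.Ico 2 n, P (edgeVR k)) :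
    ∀ t ∈ (autA n d hn).trans, P t := by
  rintro t (((h | h) | ⟨k, rfl⟩) | ⟨k, rfl⟩)
  · obtain ⟨k, ⟨j, rfl⟩ | rfl⟩ := Set.mem_iUnion.1 h
    · exact h1 k j
    · exact h2 k
  · obtain ⟨k, rfl | rfl⟩ := Set.mem_iUnion.1 h
    · exact h3 k
    · exact h4 k
  · exact h5 k
  · exact h6 k

theorem const_le_of_mem_trans {d : ℕ} {hn : 2 ≤ n} :
    ∀ t ∈ (autA n d hn).trans, ∀ a ∈ t.guard, a.const ≤ d := by
  apply forall_mem_trans <;> simp [edgeRV, edgeVR]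

theorem maxConst_autA (n d : ℕ) (hn : 2 ≤ n) : (autA n d hn).maxConst = d :=
  TBA.maxConst_eq _ const_le_of_mem_trans
    ⟨_, mem_trans_enter d hn ⟨n, hn, le_rfl⟩, _, List.mem_singleton_self _, rfl⟩

/-- The rank of a clock at the start of `R_k` when it is entered with the first (`false`) or the
second (`true`) zone. -/
def startRank (s : Bool) (k : ℕ) : Clk n → ℕ
  -- For `k = n` this is the zero valuation. Otherwise the ranks are those at `b^{k+1}` raised by
  -- one by the linking edge.
  | .x i => if k = n then 0 else if s ∧ i.1 ≤ k then 1 else i.1 + 2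
  | .y => if k = n then 0 else 2

/-- The ranks of the clocks that describe the first and the second zone at a state. -/
def clkRank (s : Bool) : Loc n → Clk n → ℕ
  | .c k j, .x i =>
    -- At `c^k_j` the clocks `x_k, …, x_{k-j+1}` have been reset, the latest having rank 0; the
    -- others have aged by `j` since the start.
    if k.1 < i.1 + j.1 ∧ i.1 ≤ k.1 then i.1 + j.1 - k.1 - 1 else startRank s k.1 (.x i) + j.1
  | .c k j, .y => startRank (n := n) s k.1 .y + j.1
  | .cy _, .x i => i.1
  | .cy _, .y => 0
  | .b k, .x i => if s ∧ i.1 < k.1 then 0 else i.1 + 1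
  | .b _, .y => 1
  | .a k, .x i => if s ∧ i.1 < k.1 then 1 else i.1 + 2
  | .a _, .y => 2

/-- The first (`false`) and the second (`true`) zone at a state of `A_n`. -/
def clkZone (d : ℕ) (s : Bool) : Loc n → Set (ClockVal (Clk n))
  | .a k => orderZone (clkRank s (.a k)) ∩ {v | v .y ≤ (d : ℝ≥0)}
  | .c k j => orderZone (clkRank s (.c k j))
  | .cy k => orderZone (clkRank s (.cy k))
  | .b k => orderZone (clkRank s (.b k))

theorem zero_mem_clkZone (d : ℕ) (s : Bool) (q : Loc n) : (fun _ => 0) ∈ clkZone d s q := by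
  cases q
  case a => exact ⟨zero_mem_orderZone _, by simp⟩
  all_goals exact zero_mem_orderZone _

theorem abstr_clkZone {d : ℕ} {hn : 2 ≤ n} (hd : 1 ≤ d) (σ : ZoneAbstraction) (s : Bool)
    (q : Loc n) : (autA n d hn).abstr σ (clkZone d s q) = clkZone d s q := by
  apply TBA.abstr_eq_self
  · rw [maxConst_autA]
    cases q
    case a => exact (isUnionOfDRegions_orderZone hd _).inter (isUnionOfDRegions_le d _)
    all_goals exact isUnionOfDRegions_orderZone hd _
  · cases q
    case a => exact (convex_orderZone _).inter (convex_le_const _ _)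
    all_goals exact convex_orderZone _

theorem clkZone_init (d : ℕ) (hn : 2 ≤ n) (s : Bool) :
    clkZone d s (autA n d hn).init = {fun _ => 0} := by
  rw [← orderZone_zero]
  have : clkRank s (.c ⟨n, hn, le_rfl⟩ 0 : Loc n) = fun _ => 0 := by
    funext p
    rcases p with i | _
    · have := i.2.2
      simp [clkRank, startRank]
    · simp [clkRank, startRank]
  exact congrArg orderZone this

/-! ### Effect of each transition on the two zones -/

theorem post_reset (d : ℕ) (s : Bool) (k : Set.Icc 2 n) (j : Fin k.1) :
    (⟨.c k j.castSucc, [],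
      {.x ⟨k.1 - j.1, by have := j.2; omega, (Nat.sub_le _ _).trans k.2.2⟩}, .c k j.succ⟩ :
        Transition (Loc n) (Clk n)).post (clkZone d s (.c k j.castSucc)) =
      clkZone d s (.c k j.succ) := by
  refine (post_orderZone _ _ _ _).trans (congrArg orderZone (funext fun p => ?_))
  have := j.2
  rcases p with i | _
  · simp only [resetRank, clkRank, Set.mem_singleton_iff, Clk.x.injEq, Subtype.ext_iff,
      Fin.val_castSucc, Fin.val_succ]
    split_ifs <;> omega
  · simp only [resetRank, clkRank, Set.mem_singleton_iff, reduceCtorEq, if_false,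
      Fin.val_castSucc, Fin.val_succ]
    omega

/-- All of `x_1, …, x_k` and `y` have now been reset, so both zones lead to `y ≤ x_1 ≤ ⋯ ≤ x_n` with
`y = 0`. The ranks may differ numerically from the listed ones; only their order and their zeros
count. -/
theorem post_resetY (d : ℕ) (s : Bool) (k : Set.Icc 2 n) :
    (⟨.c k (Fin.last k.1), [], {.y}, .cy k⟩ : Transition (Loc n) (Clk n)).post
      (clkZone d s (.c k (Fin.last k.1))) = clkZone d false (.cy k) := by
  refine (post_orderZone _ _ _ _).trans (orderZone_congr ?_ ?_)
  · rintro (⟨p, hp, hpn⟩ | _) (⟨q, hq, hqn⟩ | _) <;>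
    simp [resetRank, clkRank, startRank] <;> grind
  · rintro (p | _)
    · simp [resetRank, clkRank, startRank]
      grind
    · simp [resetRank, clkRank]

theorem post_edgeRV (d : ℕ) (s : Bool) (k : Set.Icc 2 n) :
    (edgeRV k).post (clkZone d s (.cy k)) = clkZone d false (.b k) := by
  refine (post_orderZone _ _ _ _).trans (congrArg orderZone (funext fun p => ?_))
  rcases p with i | _ <;> simp [resetRank, clkRank]

theorem post_enter (d : ℕ) (s : Bool) (k : Set.Icc 2 n) :
    (⟨.b k, [⟨.y, .le, d⟩], ∅, .a k⟩ : Transition (Loc n) (Clk n)).post (clkZone d s (.b k)) =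
      clkZone d s (.a k) := by
  refine (post_orderZone_le _ _ _ _ _).trans ?_
  rw [show resetRank ∅ (clkRank s (.b k)) = clkRank s (.a k) from ?_]
  · rfl
  · funext p
    rcases p with i | _
    · simp only [resetRank, clkRank, Set.mem_empty_iff_false, if_false]
      split_ifs <;> omega
    · simp [resetRank, clkRank]

theorem post_back (d : ℕ) (s : Bool) (k : Set.Icc 2 n) :
    (⟨.a k, [], .x '' {i | i.1 < k.1}, .b k⟩ : Transition (Loc n) (Clk n)).post
      (clkZone d s (.a k)) = clkZone d true (.b k) := by
  refine (post_orderZone_inter_le _ _ _ _ _ _ ?_).trans (orderZone_congr ?_ ?_)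
  -- The kept clocks are `y` and the `x_i` with `i ≥ k`, all of rank at least that of `y`, so the
  -- bound on `y` can be dropped.
  · rintro (i | _) hp
    · have : ¬ i.1 < k.1 := fun h => hp ⟨i, h, rfl⟩
      simp [clkRank, this]
    · exact le_rfl
  · rintro (p | _) (q | _) <;>
    simp [resetRank, clkRank] <;> grind
  · rintro (p | _) <;>
    simp [resetRank, clkRank]

theorem post_edgeVR (d : ℕ) (s : Bool) (k : Set.Ico 2 n) :
    (edgeVR k).post (clkZone d s (edgeVR k).src) = clkZone d s (edgeVR k).tgt := by
  refine (post_orderZone _ _ _ _).trans (congrArg orderZone (funext fun p => ?_))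
  have := k.2.2
  rcases p with i | _
  · have h : ¬ (k.1 < i.1 ∧ i.1 ≤ k.1) := by omega
    simp only [resetRank, clkRank, startRank, Set.mem_empty_iff_false, if_false, Fin.val_zero,
      add_zero, h, this.ne, Nat.lt_succ_iff]
    split_ifs <;> omega
  · simp [resetRank, clkRank, startRank, this.ne]

/-! ### Nodes of the zone graph of `A_n` -/

variable {d : ℕ} {hn : 2 ≤ n} {σ : ZoneAbstraction}

/-- The family of at most two zones per state is closed under every transition and fixed by the
abstraction. -/
theorem exists_eq_clkZone (hd : 1 ≤ d) {q : Loc n} {Z : Set (ClockVal (Clk n))}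
    (h : (autA n d hn).IsZoneNode σ q Z) : ∃ s, Z = clkZone d s q := by
  induction h with
  | init => exact ⟨false, (clkZone_init d hn false).symm⟩
  | step t Z ht _ _ ih =>
    obtain ⟨s, rfl⟩ := ih
    suffices ∃ s', t.post (clkZone d s t.src) = clkZone d s' t.tgt by
      obtain ⟨s', hs'⟩ := this
      exact ⟨s', by rw [hs', abstr_clkZone hd]⟩
    refine forall_mem_trans (hn := hn) (d := d)
      (P := fun t => ∃ s', t.post (clkZone d s t.src) = clkZone d s' t.tgt) ?_ ?_ ?_ ?_ ?_ ?_ t ht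
    · exact fun k j => ⟨_, post_reset d s k j⟩
    · exact fun k => ⟨_, post_resetY d s k⟩
    · exact fun k => ⟨_, post_enter d s k⟩
    · exact fun k => ⟨_, post_back d s k⟩
    · exact fun k => ⟨_, post_edgeRV d s k⟩
    · exact fun k => ⟨_, post_edgeVR d s k⟩

theorem isZoneNode_step (hd : 1 ≤ d) {t : Transition (Loc n) (Clk n)} {s s' : Bool}
    (ht : t ∈ (autA n d hn).trans) (h : (autA n d hn).IsZoneNode σ t.src (clkZone d s t.src))
    (hp : t.post (clkZone d s t.src) = clkZone d s' t.tgt) :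
    (autA n d hn).IsZoneNode σ t.tgt (clkZone d s' t.tgt) := by
  have := TBA.IsZoneNode.step t _ ht h (hp ▸ ⟨_, zero_mem_clkZone d s' t.tgt⟩)
  rwa [hp, abstr_clkZone hd] at this

theorem isZoneNode_c_of_start (hd : 1 ≤ d) (k : Set.Icc 2 n)
    (h : (autA n d hn).IsZoneNode σ (.c k 0) (clkZone d false (.c k 0))) (j : Fin (k.1 + 1)) :
    (autA n d hn).IsZoneNode σ (.c k j) (clkZone d false (.c k j)) := by
  induction j using Fin.induction with
  | zero => exact h
  | succ j ih => exact isZoneNode_step hd (mem_trans_reset d hn k j) ih (post_reset d false k j)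

theorem isZoneNode_cy_of_start (hd : 1 ≤ d) (k : Set.Icc 2 n)
    (h : (autA n d hn).IsZoneNode σ (.c k 0) (clkZone d false (.c k 0))) :
    (autA n d hn).IsZoneNode σ (.cy k) (clkZone d false (.cy k)) :=
  isZoneNode_step hd (mem_trans_resetY d hn k) (isZoneNode_c_of_start hd k h _)
    (post_resetY d false k)

theorem isZoneNode_b_of_start (hd : 1 ≤ d) (k : Set.Icc 2 n)
    (h : (autA n d hn).IsZoneNode σ (.c k 0) (clkZone d false (.c k 0))) :
    (autA n d hn).IsZoneNode σ (.b k) (clkZone d false (.b k)) :=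
  isZoneNode_step hd (mem_trans_edgeRV d hn k) (isZoneNode_cy_of_start hd k h)
    (post_edgeRV d false k)

theorem isZoneNode_start (hd : 1 ≤ d) (k : Set.Icc 2 n) :
    (autA n d hn).IsZoneNode σ (.c k 0) (clkZone d false (.c k 0)) := by
  obtain ⟨k, hk, hkn⟩ := k
  induction hkn using Nat.decreasingInduction with
  | self =>
    have := TBA.IsZoneNode.init (A := autA n d hn) (σ := σ)
    rwa [← clkZone_init d hn false] at this
  | of_succ k hkn ih =>
    exact isZoneNode_step hd (mem_trans_edgeVR d hn ⟨k, hk, hkn⟩)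
      (isZoneNode_b_of_start hd _ (ih (by omega))) (post_edgeVR d false ⟨k, hk, hkn⟩)

theorem isZoneNode_first (hd : 1 ≤ d) (q : Loc n) :
    (autA n d hn).IsZoneNode σ q (clkZone d false q) := by
  cases q with
  | c k j => exact isZoneNode_c_of_start hd k (isZoneNode_start hd k) j
  | cy k => exact isZoneNode_cy_of_start hd k (isZoneNode_start hd k)
  | b k => exact isZoneNode_b_of_start hd k (isZoneNode_start hd k)
  | a k =>
    exact isZoneNode_step hd (mem_trans_enter d hn k)
      (isZoneNode_b_of_start hd k (isZoneNode_start hd k)) (post_enter d false k)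

theorem isZoneNode_b_second (hd : 1 ≤ d) (k : Set.Icc 2 n) :
    (autA n d hn).IsZoneNode σ (.b k) (clkZone d true (.b k)) :=
  isZoneNode_step hd (mem_trans_back d hn k) (isZoneNode_first hd _) (post_back d false k)

/-- The constant valuation 1 separates the zones: the second one forces `x_1 = 0` because `1 < k`.
-/
theorem clkZone_b_ne (d : ℕ) (hn : 2 ≤ n) (k : Set.Icc 2 n) :
    clkZone d false (.b k) ≠ clkZone d true (.b k) := by
  intro h
  have h1 : (fun _ => 1 : ClockVal (Clk n)) ∈ clkZone d false (.b k) := by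
    refine ⟨fun _ _ _ => le_rfl, ?_⟩
    rintro (i | _) hp <;> simp [clkRank] at hp
  rw [h] at h1
  have hk : 1 < k.1 := k.2.1
  have := h1.2 (.x ⟨1, le_rfl, by omega⟩) (by simp [clkRank, hk])
  exact one_ne_zero this

theorem zonesAt_autA_subset (hd : 1 ≤ d) (q : Loc n) :
    (autA n d hn).zonesAt σ q ⊆ {clkZone d false q, clkZone d true q} := by
  intro Z hZ
  obtain ⟨s, rfl⟩ := exists_eq_clkZone hd hZ
  cases s
  · exact .inl rfl
  · exact .inr rfl

theorem encard_zonesAt_autA (hd : 1 ≤ d) (q : Loc n) :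
    1 ≤ ((autA n d hn).zonesAt σ q).encard ∧ ((autA n d hn).zonesAt σ q).encard ≤ 2 :=
  by
  refine ⟨Set.one_le_encard_iff_nonempty.2 ⟨_, isZoneNode_first hd q⟩, ?_⟩
  refine (Set.encard_le_encard (zonesAt_autA_subset hd q)).trans
    ((Set.encard_insert_le _ _).trans ?_)
  rw [Set.encard_singleton, one_add_one_eq_two]

theorem encard_zonesAt_autA_b (hd : 1 ≤ d) (k : Set.Icc 2 n) :
    ((autA n d hn).zonesAt σ (.b k)).encard = 2 := by
  rw [← Set.encard_pair (clkZone_b_ne d hn k)]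
  refine congrArg _ ((zonesAt_autA_subset hd _).antisymm ?_)
  rintro Z (rfl | rfl)
  · exact isZoneNode_first hd _
  · exact isZoneNode_b_second hd k

theorem encard_range_le {α β : Type*} [Finite α] (f : α → β) :
    (Set.range f).encard ≤ (Nat.card α : ℕ∞) := by
  rw [← Set.image_univ]
  refine (Set.encard_image_le _ _).trans ?_
  rw [Set.encard_univ, ENat.card_eq_coe_natCard]

theorem encard_zoneNodes_autA (hd : 1 ≤ d) :
    ((autA n d hn).zoneNodes σ).encard ≤ ((2 * Nat.card (Loc n) : ℕ) : ℕ∞) := by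
  have h : (autA n d hn).zoneNodes σ ⊆
      Set.range fun p : Bool × Loc n => (p.2, clkZone d p.1 p.2) := by
    rintro ⟨q, Z⟩ hZ
    obtain ⟨s, rfl : Z = clkZone d s q⟩ := exists_eq_clkZone hd hZ
    exact ⟨(s, q), rfl⟩
  refine (Set.encard_le_encard h).trans ((encard_range_le _).trans ?_)
  simp

theorem encard_zoneNodes_autA_gadgetV (hd : 1 ≤ d) :
    {p ∈ (autA n d hn).zoneNodes σ | ∃ k, p.1 = .a k ∨ p.1 = .b k}.encard ≤
      ((4 * (n - 1) : ℕ) : ℕ∞) := by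
  let st : Bool → Set.Icc 2 n → Loc n := fun e k => bif e then .a k else .b k
  have h : {p ∈ (autA n d hn).zoneNodes σ | ∃ k, p.1 = .a k ∨ p.1 = .b k} ⊆
      Set.range fun p : (Bool × Bool) × Set.Icc 2 n =>
        (st p.1.1 p.2, clkZone d p.1.2 (st p.1.1 p.2)) := by
    rintro ⟨q, Z⟩ ⟨hZ, k, hq⟩
    obtain ⟨s, rfl : Z = clkZone d s q⟩ := exists_eq_clkZone hd hZ
    rcases hq with rfl | rfl
    · exact ⟨((true, s), k), rfl⟩
    · exact ⟨((false, s), k), rfl⟩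
  refine (Set.encard_le_encard h).trans ((encard_range_le _).trans ?_)
  simp

end AutA

/-! ### The strongly non-Zeno transformation of `A_n` -/

section SnzAutA

variable {n d N : ℕ} {hn : 2 ≤ n} {σ : ZoneAbstraction}

theorem snzKeep_mem_trans {Q X : Type} [Finite Q] [Finite X] (N : ℕ) {A : TBA Q X}
    {t : Transition Q X} (ht : t ∈ A.trans) : snzKeep A.acc t ∈ (snzWith N A).trans :=
  .inl (.inl ⟨t, ht, rfl⟩)

theorem snzEnter_mem_trans {Q X : Type} [Finite Q] [Finite X] (N : ℕ) {A : TBA Q X}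
    {t : Transition Q X} (ht : t ∈ A.trans) (q : A.acc) (hq : t.tgt = q) :
    snzEnter N A.acc t q ∈ (snzWith N A).trans :=
  .inl (.inr ⟨t, ht, q, hq, rfl⟩)

theorem snzLeave_mem_trans {Q X : Type} [Finite Q] [Finite X] (N : ℕ) (A : TBA Q X)
    (q : A.acc) : snzLeave A.acc q ∈ (snzWith N A).trans :=
  .inr ⟨q, rfl⟩

theorem maxConst_snzWith_autA (hN : N ≤ d) : (snzWith N (autA n d hn)).maxConst = d := by
  have lift_le : ∀ t ∈ (autA n d hn).trans, ∀ a ∈ t.guard.lift, a.const ≤ d := by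
    intro t ht a ha
    obtain ⟨b, hb, rfl⟩ := List.mem_map.1 ha
    exact const_le_of_mem_trans t ht b hb
  refine TBA.maxConst_eq _ ?_ ⟨_, snzKeep_mem_trans N (mem_trans_enter d hn ⟨n, hn, le_rfl⟩), _,
    List.mem_singleton_self _, rfl⟩
  rintro _ ((⟨t, ht, rfl⟩ | ⟨t, ht, q, -, rfl⟩) | ⟨q, rfl⟩) a ha
  · exact lift_le t ht a ha
  · rcases List.mem_cons.1 ha with rfl | ha
    · exact hN
    · exact lift_le t ht a ha
  · cases ha

/-! ### Difference bounds and tight valuations for `SNZ(A_n)` -/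

/-- The bounds `m j` on `x_j - x_{j-1}` for `j > k`. -/
def chainBound (m : ℕ → ℕ) (k : ℕ) (p q : Option (Clk n)) (c : ℕ) : Prop :=
  ∃ i j : Set.Icc 1 n, i.1 + 1 = j.1 ∧ k < j.1 ∧ p = some (.x j) ∧ q = some (.x i) ∧ c = m j

/-- The bounds `m j` on `x_j - x_{j-1}` for `j > k` and the bound `e` on `x_k - z`. -/
def loopBound (m : ℕ → ℕ) (k e : ℕ) (p q : Option (Clk n)) (c : ℕ) : Prop :=
  chainBound m k p q c ∨ ∃ i : Set.Icc 1 n, i.1 = k ∧ p = some (.x i) ∧ q = none ∧ c = e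

/-- The difference `x_j - x_{j-1}` equals `m j`, if `j > k`. -/
def ChainTight (m : ℕ → ℕ) (k : ℕ) (j : Set.Icc 1 n) (v : ClockVal (Option (Clk n))) : Prop :=
  ∀ i : Set.Icc 1 n, i.1 + 1 = j.1 → k < j.1 → v (some (.x j)) = v (some (.x i)) + m j

/-- The witness for the index `j` when `V_k` is left: the bound with index `j` is tight. -/
def ExitWitness (m : ℕ → ℕ) (k : ℕ) (j : Set.Icc 1 n) (v : ClockVal (Option (Clk n))) : Prop :=
  ChainTight m k j v ∧ (j.1 = k → v none = 0 ∧ v (some (.x j)) = m k)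

/-- The witness for the index `j` inside `R_k`. -/
def ResetWitness (N : ℕ) (m : ℕ → ℕ) (k : ℕ) (j : Set.Icc 1 n) (v : ClockVal (Option (Clk n))) :
    Prop :=
  ChainTight m k j v ∧ (j.1 = k → v (some (.x j)) = 0 ∧ (N : ℝ≥0) ≤ v none)

/-- The witness for the index `j` when `V_k` is entered. -/
def EntryWitness (N : ℕ) (m : ℕ → ℕ) (k : ℕ) (j : Set.Icc 1 n) (v : ClockVal (Option (Clk n))) :
    Prop :=
  ChainTight m k j v ∧ (j.1 = k → v (some (.x j)) = 0) ∧ v (some .y) = 0 ∧ (N : ℝ≥0) ≤ v none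

/-- The witness for the index `j` while looping in `V_k`. -/
def LoopWitness (m : ℕ → ℕ) (k e : ℕ) (j : Set.Icc 1 n) (v : ClockVal (Option (Clk n))) : Prop :=
  ChainTight m k j v ∧ (j.1 = k → v (some (.x j)) = e) ∧ v (some .y) = e ∧ v none = 0

theorem reset_delay_apply_of_notMem {X : Type} {R : Set X} {p : X} (v : ClockVal X) (δ : ℝ≥0)
    (h : p ∉ R) : (v.delay δ).reset R p = v p + δ :=
  ClockVal.reset_of_notMem _ h

theorem ChainTight.reset_delay {m : ℕ → ℕ} {k : ℕ} {j : Set.Icc 1 n}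
    {v : ClockVal (Option (Clk n))} (h : ChainTight m k j v) {R : Set (Option (Clk n))}
    (hR : ∀ i : Set.Icc 1 n, k ≤ i.1 → some (.x i) ∉ R) (δ : ℝ≥0) :
    ChainTight m k j ((v.delay δ).reset R) := by
  intro i hi hk
  rw [reset_delay_apply_of_notMem _ _ (hR j (by omega)),
    reset_delay_apply_of_notMem _ _ (hR i (by omega)), h i hi hk, add_right_comm]

theorem enclosed_step (hd : 1 ≤ d) (hN : N ≤ d)
    {t : Transition (Loc n ⊕ (autA n d hn).acc) (Option (Clk n))}
    {T T' : Set.Icc 1 n → ClockVal (Option (Clk n)) → Prop}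
    {C C' : Option (Clk n) → Option (Clk n) → ℕ → Prop}
    (h : (snzWith N (autA n d hn)).Enclosed σ t.src T (diffZone d C))
    (ht : t ∈ (snzWith N (autA n d hn)).trans)
    (hT : ∀ j v, T j v → ∃ δ, t.guard.Sat (v.delay δ) ∧ T' j ((v.delay δ).reset t.resets))
    (hC : ∀ p q c, C' p q c → p ∉ t.resets ∧ (C p q c ∨ q ∈ t.resets ∧
      (c = 0 ∨ (∃ q', C p q' c) ∨
        ∃ c', C p q c' ∧ c = c' + N ∧ c' < d ∧ c ≤ d ∧ ⟨q, .ge, N⟩ ∈ t.guard))) :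
    (snzWith N (autA n d hn)).Enclosed σ t.tgt T' (diffZone d C') := by
  have : Nonempty (Set.Icc 1 n) := ⟨⟨1, le_rfl, by omega⟩⟩
  refine h.step ht hT (post_diffZone_subset hC) ?_ (convex_diffZone _ _)
  rw [maxConst_snzWith_autA hN]
  exact isUnionOfDRegions_diffZone hd _

/-! ### Passing through the gadget `R_k` -/

variable {m : ℕ → ℕ}

/-- The first reset of `R_k` stores the bound on `x_{k+1} - z` as one on `x_{k+1} - x_k`. This is
also why there is one witness per index: a witness leaving `V_{k+1}` with `z = 0` must wait until `z
≥ N`. Waiting before the reset of `x_k` spoils tightness at `k + 1`, waiting after it spoils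
tightness at `k`. So index `k` waits here and all the others wait in `enclosed_cy`. -/
theorem enclosed_c_one (hd : 1 ≤ d) (hN : N ≤ d) (k : Set.Icc 2 n)
    (h : (snzWith N (autA n d hn)).Enclosed σ (.inl (.c k 0)) (ExitWitness m (k + 1))
      (diffZone d (loopBound m (k + 1) (m (k + 1))))) :
    (snzWith N (autA n d hn)).Enclosed σ (.inl (.c k ⟨1, by have := k.2.1; omega⟩))
      (ResetWitness N m k) (diffZone d (chainBound m k)) := by
  refine enclosed_step hd hN h (snzKeep_mem_trans N (mem_trans_reset d hn k
    ⟨0, by have := k.2.1; omega⟩)) ?_ ?_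
  · rintro j v ⟨hv, hvk⟩
    by_cases hj : j.1 = k.1
    · refine ⟨N, Guard.sat_nil _, fun i hi hk => by omega, fun _ => ⟨?_, ?_⟩⟩
      · exact ClockVal.reset_of_mem _ ⟨_, by simp [Subtype.ext_iff, hj], rfl⟩
      · rw [reset_delay_apply_of_notMem _ _ (by simp [snzKeep])]
        exact le_add_self
    · refine ⟨0, Guard.sat_nil _, fun i hi hk => ?_, fun h => absurd h hj⟩
      rw [reset_delay_apply_of_notMem _ _ (by simp [snzKeep, Subtype.ext_iff, hj])]
      by_cases hj' : j.1 = k.1 + 1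
      · rw [ClockVal.reset_of_mem (p := some (Clk.x i)) _ (by simp [snzKeep, Subtype.ext_iff]; omega),
          (hvk hj').2]
        simp [hj']
      · rw [reset_delay_apply_of_notMem _ _ (by simp [snzKeep, Subtype.ext_iff]; omega),
          hv i hi (by omega), add_right_comm]
  · rintro _ _ _ ⟨i, j, hij, hj, rfl, rfl, rfl⟩
    refine ⟨by simp [snzKeep, Subtype.ext_iff]; omega, ?_⟩
    by_cases hj' : j.1 = k.1 + 1
    · exact .inr ⟨⟨_, by simp [Subtype.ext_iff]; omega, rfl⟩,
        .inr (.inl ⟨none, .inr ⟨j, hj', rfl, rfl, by rw [hj']⟩⟩)⟩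
    · exact .inl (.inl ⟨i, j, hij, by omega, rfl, rfl, rfl⟩)

theorem enclosed_c_succ (hd : 1 ≤ d) (hN : N ≤ d) (k : Set.Icc 2 n)
    (h : (snzWith N (autA n d hn)).Enclosed σ (.inl (.c k 0)) (ExitWitness m (k + 1))
      (diffZone d (loopBound m (k + 1) (m (k + 1))))) (i : ℕ) (hi : i < k.1) :
    (snzWith N (autA n d hn)).Enclosed σ (.inl (.c k ⟨i + 1, by omega⟩))
      (ResetWitness N m k) (diffZone d (chainBound m k)) := by
  induction i with
  | zero => exact enclosed_c_one hd hN k h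
  | succ i ih =>
    refine enclosed_step hd hN (ih (by omega)) (snzKeep_mem_trans N (mem_trans_reset d hn k
      ⟨i + 1, hi⟩)) ?_ ?_
    · rintro j v ⟨hv, hvk⟩
      refine ⟨0, Guard.sat_nil _, hv.reset_delay (fun i hi => ?_) 0, fun hj => ?_⟩
      · simp [snzKeep, Subtype.ext_iff]
        omega
      · rw [reset_delay_apply_of_notMem _ _ (by simp [snzKeep, Subtype.ext_iff]; omega),
          reset_delay_apply_of_notMem _ _ (by simp [snzKeep]), add_zero, add_zero]
        exact hvk hj
    · rintro _ _ _ ⟨i, j, hij, hj, rfl, rfl, rfl⟩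
      refine ⟨by simp [snzKeep, Subtype.ext_iff]; omega, ?_⟩
      exact .inl ⟨i, j, hij, hj, rfl, rfl, rfl⟩

theorem enclosed_cy (hd : 1 ≤ d) (hN : N ≤ d) (k : Set.Icc 2 n)
    (h : (snzWith N (autA n d hn)).Enclosed σ (.inl (.c k (Fin.last k.1)))
      (ResetWitness N m k) (diffZone d (chainBound m k))) :
    (snzWith N (autA n d hn)).Enclosed σ (.inl (.cy k))
      (EntryWitness N m k) (diffZone d (chainBound m k)) := by
  refine enclosed_step hd hN h (snzKeep_mem_trans N (mem_trans_resetY d hn k)) ?_ ?_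
  · rintro j v ⟨hv, hvk⟩
    by_cases hj : j.1 = k.1
    · refine ⟨0, Guard.sat_nil _, hv.reset_delay (by simp [snzKeep]) 0, fun _ => ?_, ?_, ?_⟩
      · rw [reset_delay_apply_of_notMem _ _ (by simp [snzKeep]), (hvk hj).1, add_zero]
      · exact ClockVal.reset_of_mem _ ⟨_, rfl, rfl⟩
      · rw [reset_delay_apply_of_notMem _ _ (by simp [snzKeep]), add_zero]
        exact (hvk hj).2
    · refine ⟨N, Guard.sat_nil _, hv.reset_delay (by simp [snzKeep]) N,
        fun h => absurd h hj, ?_, ?_⟩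
      · exact ClockVal.reset_of_mem _ ⟨_, rfl, rfl⟩
      · rw [reset_delay_apply_of_notMem _ _ (by simp [snzKeep])]
        exact le_add_self
  · rintro _ _ _ ⟨i, j, hij, hj, rfl, rfl, rfl⟩
    exact ⟨by simp [snzKeep], .inl ⟨i, j, hij, hj, rfl, rfl, rfl⟩⟩

theorem enclosed_b_entry (hd : 1 ≤ d) (hN : N ≤ d) (k : Set.Icc 2 n)
    (h : (snzWith N (autA n d hn)).Enclosed σ (.inl (.cy k))
      (EntryWitness N m k) (diffZone d (chainBound m k))) :
    (snzWith N (autA n d hn)).Enclosed σ (.inl (.b k))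
      (EntryWitness N m k) (diffZone d (chainBound m k)) := by
  refine enclosed_step hd hN h (snzKeep_mem_trans N (mem_trans_edgeRV d hn k)) ?_ ?_
  · intro j v hv
    refine ⟨0, Guard.sat_nil _, ?_⟩
    convert hv using 1
    ext p
    simp [snzKeep, edgeRV, ClockVal.reset, ClockVal.delay]
  · exact fun p q c hC => ⟨by simp [snzKeep, edgeRV], .inl hC⟩

/-! ### Looping in the gadget `V_k` -/

/-- From the accepting copy of `a^k` back to `b^k`. -/
theorem enclosed_b_of_a {e : ℕ} (hd : 1 ≤ d) (hN : N ≤ d) (k : Set.Icc 2 n)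
    (h : (snzWith N (autA n d hn)).Enclosed σ (.inr ⟨.a k, k, rfl⟩)
      (LoopWitness m k e) (diffZone d (loopBound m k e))) :
    (snzWith N (autA n d hn)).Enclosed σ (.inl (.b k))
      (LoopWitness m k e) (diffZone d (loopBound m k e)) := by
  have h1 : (snzWith N (autA n d hn)).Enclosed σ (.inl (.a k))
      (LoopWitness m k e) (diffZone d (loopBound m k e)) := by
    refine enclosed_step hd hN h (snzLeave_mem_trans N _ _) ?_ ?_
    · intro j v hv
      refine ⟨0, Guard.sat_nil _, ?_⟩
      convert hv using 1
      ext p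
      simp [snzLeave, ClockVal.reset, ClockVal.delay]
    · exact fun p q c hC => ⟨by simp [snzLeave], .inl hC⟩
  have hR : ∀ i : Set.Icc 1 n, k.1 ≤ i.1 →
      some (Clk.x i) ∉ some '' (Clk.x '' {i : Set.Icc 1 n | i.1 < k.1}) := by
    rintro i hi ⟨_, ⟨i', hi', rfl⟩, h⟩
    simp only [Option.some.injEq, Clk.x.injEq] at h
    exact absurd hi' (by simp [h, hi])
  refine enclosed_step hd hN h1 (snzKeep_mem_trans N (mem_trans_back d hn k)) ?_ ?_
  · rintro j v ⟨hv, hvk, hvy, hvz⟩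
    refine ⟨0, Guard.sat_nil _, hv.reset_delay hR 0, fun hj => ?_, ?_, ?_⟩
    · exact (reset_delay_apply_of_notMem _ _ (hR j hj.ge)).trans (by rw [add_zero, hvk hj])
    · rw [reset_delay_apply_of_notMem _ _ (by simp [snzKeep]), add_zero, hvy]
    · rw [reset_delay_apply_of_notMem _ _ (by simp [snzKeep]), add_zero, hvz]
  · rintro p q c hC
    refine ⟨?_, .inl hC⟩
    rcases hC with ⟨i, j, _, hj, rfl, _⟩ | ⟨j, hj, rfl, _⟩
    · exact hR j hj.le
    · exact hR j hj.ge

theorem some_notMem_resets_snzEnter (k : Set.Icc 2 n) (p : Clk n) : some p ∉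
    (snzEnter N (autA n d hn).acc
      (⟨.b k, [⟨.y, .le, d⟩], ∅, .a k⟩ : Transition (Loc n) (Clk n))
      ⟨.a k, k, rfl⟩).resets := by
  simp [snzEnter]

theorem none_mem_resets_snzEnter (k : Set.Icc 2 n) : none ∈
    (snzEnter N (autA n d hn).acc
      (⟨.b k, [⟨.y, .le, d⟩], ∅, .a k⟩ : Transition (Loc n) (Clk n))
      ⟨.a k, k, rfl⟩).resets :=
  .inl rfl

/-- The first pass takes no time for the witnesses and resets `z`; it gains only the trivial bound
`x_k - z ≥ 0`. -/
theorem enclosed_loop_zero (hd : 1 ≤ d) (hN : N ≤ d) (k : Set.Icc 2 n)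
    (h : (snzWith N (autA n d hn)).Enclosed σ (.inl (.b k))
      (EntryWitness N m k) (diffZone d (chainBound m k))) :
    (snzWith N (autA n d hn)).Enclosed σ (.inl (.b k))
      (LoopWitness m k 0) (diffZone d (loopBound m k 0)) := by
  refine enclosed_b_of_a hd hN k (enclosed_step hd hN h
    (snzEnter_mem_trans N (mem_trans_enter d hn k) _ rfl) ?_ ?_)
  · rintro j v ⟨hv, hvk, hvy, hvz⟩
    refine ⟨0, Guard.sat_cons.2 ⟨?_, Guard.sat_lift.2 (Guard.sat_cons.2 ⟨?_, Guard.sat_nil _⟩)⟩,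
      hv.reset_delay (fun i _ => some_notMem_resets_snzEnter k _) 0, fun hj => ?_, ?_, ?_⟩
    · simpa [Cmp.Holds, ClockVal.delay] using hvz
    · simp [Cmp.Holds, ClockVal.delay, hvy]
    · rw [reset_delay_apply_of_notMem _ _ (some_notMem_resets_snzEnter k _), hvk hj]
      simp
    · rw [reset_delay_apply_of_notMem _ _ (some_notMem_resets_snzEnter k _), hvy]
      simp
    · exact ClockVal.reset_of_mem _ (none_mem_resets_snzEnter k)
  · rintro p q c (hC | ⟨i, hi, rfl, rfl, rfl⟩)
    · refine ⟨?_, .inl hC⟩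
      obtain ⟨i, j, _, hj, rfl, _⟩ := hC
      exact some_notMem_resets_snzEnter k _
    · exact ⟨some_notMem_resets_snzEnter k _, .inr ⟨none_mem_resets_snzEnter k, .inl rfl⟩⟩

/-- From `x_k - z ≥ e` and the guard `z ≥ N` follows `x_k ≥ e + N`, and `z` is then reset. Witnesses
wait exactly `N`, which `y = e` and `e + N ≤ d` permit. Since `e < d`, the old bound is not yet in
its relaxed form. -/
theorem enclosed_loop_add {e : ℕ} (hd : 1 ≤ d) (hN1 : 1 ≤ N) (hN : N ≤ d) (k : Set.Icc 2 n)
    (he : e + N ≤ d)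
    (h : (snzWith N (autA n d hn)).Enclosed σ (.inl (.b k))
      (LoopWitness m k e) (diffZone d (loopBound m k e))) :
    (snzWith N (autA n d hn)).Enclosed σ (.inl (.b k))
      (LoopWitness m k (e + N)) (diffZone d (loopBound m k (e + N))) := by
  refine enclosed_b_of_a hd hN k (enclosed_step hd hN h
    (snzEnter_mem_trans N (mem_trans_enter d hn k) _ rfl) ?_ ?_)
  · rintro j v ⟨hv, hvk, hvy, hvz⟩
    refine ⟨N, Guard.sat_cons.2 ⟨?_, Guard.sat_lift.2 (Guard.sat_cons.2 ⟨?_, Guard.sat_nil _⟩)⟩,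
      hv.reset_delay (fun i _ => some_notMem_resets_snzEnter k _) N, fun hj => ?_, ?_, ?_⟩
    · simp [Cmp.Holds, ClockVal.delay]
    · simp only [Cmp.Holds, ClockVal.delay, hvy]
      exact_mod_cast he
    · rw [reset_delay_apply_of_notMem _ _ (some_notMem_resets_snzEnter k _), hvk hj, Nat.cast_add]
    · rw [reset_delay_apply_of_notMem _ _ (some_notMem_resets_snzEnter k _), hvy, Nat.cast_add]
    · exact ClockVal.reset_of_mem _ (none_mem_resets_snzEnter k)
  · rintro p q c (hC | ⟨i, hi, rfl, rfl, rfl⟩)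
    · refine ⟨?_, .inl (.inl hC)⟩
      obtain ⟨i, j, _, hj, rfl, _⟩ := hC
      exact some_notMem_resets_snzEnter k _
    · exact ⟨some_notMem_resets_snzEnter k _, .inr ⟨none_mem_resets_snzEnter k,
        .inr (.inr ⟨e, .inr ⟨i, hi, rfl, rfl, rfl⟩, rfl, by omega, he, .head _⟩)⟩⟩

theorem enclosed_loop (hd : 1 ≤ d) (hN1 : 1 ≤ N) (hN : N ≤ d) (k : Set.Icc 2 n)
    (h : (snzWith N (autA n d hn)).Enclosed σ (.inl (.b k))
      (EntryWitness N m k) (diffZone d (chainBound m k))) (i : ℕ) (hi : N * i ≤ d) :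
    (snzWith N (autA n d hn)).Enclosed σ (.inl (.b k))
      (LoopWitness m k (N * i)) (diffZone d (loopBound m k (N * i))) := by
  induction i with
  | zero => exact enclosed_loop_zero hd hN k h
  | succ i ih => exact enclosed_loop_add hd hN1 hN k hi (ih ((by gcongr; omega : _ ≤ _).trans hi))

/-! ### Descending from `R_n` to `V_k` -/

variable {f : ℕ → ℕ}

/-- The node at `b^k` reached by looping `f j + 1` times in `V_j` for all `j ≥ k`, provided that
the start of `R_k` has been reached. -/
theorem enclosed_b_of_start (hd : 1 ≤ d) (hN1 : 1 ≤ N) (hN : N ≤ d) (hf : ∀ j, N * f j ≤ d)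
    (k : Set.Icc 2 n)
    (h : (snzWith N (autA n d hn)).Enclosed σ (.inl (.c k 0))
      (ExitWitness (fun j => N * f j) (k + 1))
      (diffZone d (loopBound (fun j => N * f j) (k + 1) (N * f (k + 1))))) :
    (snzWith N (autA n d hn)).Enclosed σ (.inl (.b k)) (ExitWitness (fun j => N * f j) k)
      (diffZone d (loopBound (fun j => N * f j) k (N * f k))) := by
  have hk : k.1 - 1 + 1 = k.1 := by have := k.2.1; omega
  have h1 := enclosed_c_succ hd hN k h (k.1 - 1) (by omega)
  rw [show (⟨k.1 - 1 + 1, by omega⟩ : Fin (k.1 + 1)) = Fin.last k.1 from Fin.ext hk] at h1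
  obtain ⟨Z, hZ, hU, hT⟩ := enclosed_loop hd hN1 hN k
    (enclosed_b_entry hd hN k (enclosed_cy hd hN k h1)) (f k) (hf k)
  refine ⟨Z, hZ, hU, fun j => ?_⟩
  obtain ⟨v, hv, h1, h2, -, h3⟩ := hT j
  exact ⟨v, hv, h1, fun hj => ⟨h3, h2 hj⟩⟩

theorem enclosed_start (hd : 1 ≤ d) (hN1 : 1 ≤ N) (hN : N ≤ d) (hf : ∀ j, N * f j ≤ d)
    (k : Set.Icc 2 n) :
    (snzWith N (autA n d hn)).Enclosed σ (.inl (.c k 0))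
      (ExitWitness (fun j => N * f j) (k + 1))
      (diffZone d (loopBound (fun j => N * f j) (k + 1) (N * f (k + 1)))) := by
  obtain ⟨k, hk, hkn⟩ := k
  induction hkn using Nat.decreasingInduction with
  | self =>
    -- At the start of `R_n` all bounds and witness conditions are vacuous, as no clock has index
    -- above `n`.
    refine ⟨_, .init, ?_, fun j => ⟨_, rfl, fun i _ hj => ?_, fun hj => ?_⟩⟩
    · rintro v - p q c (⟨i, j, _, hj, _⟩ | ⟨j, hj, _⟩)
      · exact absurd j.2.2 (by simp at hj; omega)
      · exact absurd j.2.2 (by simp at hj; omega)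
    · exact absurd j.2.2 (by simp at hj; omega)
    · exact absurd j.2.2 (by simp at hj; omega)
  | of_succ k hkn ih =>
    refine enclosed_step hd hN (enclosed_b_of_start hd hN1 hN hf _ (ih (by omega)))
      (snzKeep_mem_trans N (mem_trans_edgeVR d hn ⟨k, hk, hkn⟩)) ?_ ?_
    · intro j v hv
      refine ⟨0, Guard.sat_nil _, ?_⟩
      convert hv using 1
      ext p
      simp [snzKeep, edgeVR, ClockVal.reset, ClockVal.delay]
    · exact fun p q c hC => ⟨by simp [snzKeep, edgeVR], .inl hC⟩

theorem enclosed_b (hd : 1 ≤ d) (hN1 : 1 ≤ N) (hN : N ≤ d) (hf : ∀ j, N * f j ≤ d)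
    (k : Set.Icc 2 n) :
    (snzWith N (autA n d hn)).Enclosed σ (.inl (.b k)) (ExitWitness (fun j => N * f j) k)
      (diffZone d (loopBound (fun j => N * f j) k (N * f k))) :=
  enclosed_b_of_start hd hN1 hN hf k (enclosed_start hd hN1 hN hf k)

/-! ### Distinguishing and counting the zones -/

/-- A zone with tight witnesses for `m` that satisfies the bounds for `m'` gives `m' ≤ m`. -/
theorem le_of_exitWitness {m m' : ℕ → ℕ} {k : ℕ} (hk : 2 ≤ k) (hm' : ∀ j, m' j ≤ d)
    {Z : Set (ClockVal (Option (Clk n)))} (hT : ∀ j, ∃ v ∈ Z, ExitWitness m k j v)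
    (hU : Z ⊆ diffZone d (loopBound m' k (m' k))) (j : Set.Icc k n) : m' j ≤ m j := by
  obtain ⟨j, hkj, hjn⟩ := j
  let jj : Set.Icc 1 n := ⟨j, by omega, hjn⟩
  obtain ⟨v, hv, hc, he⟩ := hT jj
  rcases hkj.eq_or_lt with rfl | hlt
  · obtain ⟨h0, h1⟩ := he rfl
    have := hU hv (some (.x jj)) none (m' k) (.inr ⟨jj, rfl, rfl, rfl, rfl⟩)
    rw [h1, h0, ← zero_add (m k : ℝ≥0)] at this
    exact this.le_of_nat (hm' k)
  · let ii : Set.Icc 1 n := ⟨j - 1, by omega, by omega⟩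
    have hij : ii.1 + 1 = jj.1 := Nat.sub_add_cancel (by omega)
    have := hU hv (some (.x jj)) (some (.x ii)) (m' j) (.inl ⟨ii, jj, hij, hlt, rfl, rfl, rfl⟩)
    rw [hc ii hij hlt] at this
    exact this.le_of_nat (hm' j)

theorem le_encard_zonesAt_snzWith (hd : 1 ≤ d) (hN1 : 1 ≤ N) (hN : N ≤ d) (k : Set.Icc 2 n) :
    (((d / N + 1) ^ (n - k.1 + 1) : ℕ) : ℕ∞) ≤
      ((snzWith N (autA n d hn)).zonesAt σ (.inl (.b k))).encard := by
  classical
  -- The loop counts are chosen freely in `{0, …, d / N}` for the gadgets `V_k, …, V_n`; the value 0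
  -- elsewhere only keeps `N * f j ≤ d` true.
  let ext : (Set.Icc k.1 n → Fin (d / N + 1)) → ℕ → ℕ := fun g j =>
    if h : j ∈ Set.Icc k.1 n then g ⟨j, h⟩ else 0
  have hext : ∀ g j, N * ext g j ≤ d := by
    intro g j
    by_cases h : j ∈ Set.Icc k.1 n
    · simp only [ext, h, dif_pos]
      calc N * (g ⟨j, h⟩ : ℕ) ≤ N * (d / N) := by gcongr; exact Nat.le_of_lt_succ (g _).2
        _ ≤ d := Nat.mul_div_le d N
    · simp only [ext, h, not_false_eq_true, dif_neg, mul_zero, zero_le]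
  choose Z hZ hU hT using fun g => enclosed_b (hn := hn) (σ := σ) hd hN1 hN (hext g) k
  have hinj : Function.Injective Z := by
    intro g g' hgg
    funext j
    have h1 := le_of_exitWitness k.2.1 (hext g') (hT g) (hgg ▸ hU g') j
    have h2 := le_of_exitWitness k.2.1 (hext g) (hT g') (hgg ▸ hU g) j
    have h3 := Nat.eq_of_mul_eq_mul_left (by omega) (h1.antisymm h2)
    simp only [ext, j.2, dif_pos] at h3
    exact Fin.ext h3.symm
  have hcard : (Set.range Z).encard = (((d / N + 1) ^ (n - k.1 + 1) : ℕ) : ℕ∞) := by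
    rw [← Set.image_univ, hinj.encard_image, Set.encard_univ, ENat.card_eq_coe_natCard]
    have hk := k.2.2
    simp
    congr 1
    omega
  rw [← hcard]
  exact Set.encard_le_encard (Set.range_subset_iff.2 hZ)

theorem TBA.encard_zonesAt_le_encard_zones {Q X : Type} [Finite Q] [Finite X] (A : TBA Q X)
    (σ : ZoneAbstraction) (q : Q) : (A.zonesAt σ q).encard ≤ (A.zones σ).encard :=
  Set.encard_le_encard fun _ hZ => ⟨q, hZ⟩

theorem TBA.encard_zones_le_encard_zoneNodes {Q X : Type} [Finite Q] [Finite X] (A : TBA Q X)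
    (σ : ZoneAbstraction) : (A.zones σ).encard ≤ (A.zoneNodes σ).encard := by
  have h : A.zones σ ⊆ Prod.snd '' A.zoneNodes σ := fun Z ⟨q, hZ⟩ => ⟨(q, Z), hZ, rfl⟩
  exact (Set.encard_le_encard h).trans (Set.encard_image_le _ _)

/-- The exponential lower bounds for the zone graph of the strongly non-Zeno transformation. -/
theorem snzWith_autA_blowup (hd : 1 ≤ d) (hN1 : 1 ≤ N) (hN : N ≤ d) :
    (∀ k : Set.Icc 2 n, (((d / N + 1) ^ (n - k.1 + 1) : ℕ) : ℕ∞) ≤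
      ((snzWith N (autA n d hn)).zonesAt σ (.inl (.b k))).encard) ∧
    (((d / N + 1) ^ (n - 1) : ℕ) : ℕ∞) ≤ ((snzWith N (autA n d hn)).zones σ).encard ∧
    (((d / N + 1) ^ (n - 1) : ℕ) : ℕ∞) ≤ ((snzWith N (autA n d hn)).zoneNodes σ).encard := by
  have h := le_encard_zonesAt_snzWith (hn := hn) (σ := σ) hd hN1 hN
  have h2 := (h ⟨2, le_rfl, hn⟩).trans (TBA.encard_zonesAt_le_encard_zones _ _ _)
  simp only [show n - 2 + 1 = n - 1 by omega] at h2
  exact ⟨h, h2, h2.trans (TBA.encard_zones_le_encard_zoneNodes _ _)⟩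

end SnzAutA

theorem mainTheorem3 (n d : ℕ) (hn : 2 ≤ n) (hd : 1 ≤ d) :
    -- the numbers of clocks of `A_n` and `B_n`, and the number of states of `A_n`
    (Nat.card (Clk n) = n + 1 ∧ Nat.card (Option (Clk n)) = n + 2 ∧
      2 * Nat.card (Loc n) = (n - 1) * (n + 10)) ∧
    ∀ σ : ZoneAbstraction,
      -- the zone graph of `A_n` is small
      ((∀ q : Loc n, 1 ≤ ((autA n d hn).zonesAt σ q).encard ∧
          ((autA n d hn).zonesAt σ q).encard ≤ 2) ∧
        (∀ k : Set.Icc 2 n, ((autA n d hn).zonesAt σ (.b k)).encard = 2) ∧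
        {p ∈ (autA n d hn).zoneNodes σ | ∃ k, p.1 = .a k ∨ p.1 = .b k}.encard
          ≤ ((4 * (n - 1) : ℕ) : ℕ∞) ∧
        ((autA n d hn).zoneNodes σ).encard ≤ ((2 * Nat.card (Loc n) : ℕ) : ℕ∞)) ∧
      -- exponential blowup for `B_n = SNZ(A_n)`
      ((∀ k : Set.Icc 2 n, (((d + 1) ^ (n - k.1 + 1) : ℕ) : ℕ∞)
          ≤ ((autB n d hn).zonesAt σ (.inl (.b k))).encard) ∧
        (((d + 1) ^ (n - 1) : ℕ) : ℕ∞) ≤ ((autB n d hn).zones σ).encard ∧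
        (((d + 1) ^ (n - 1) : ℕ) : ℕ∞) ≤ ((autB n d hn).zoneNodes σ).encard) ∧
      -- exponential blowup with the guard `z ≥ d`
      ((∀ k : Set.Icc 2 n, ((2 ^ (n - k.1 + 1) : ℕ) : ℕ∞)
          ≤ ((autBMax n d hn).zonesAt σ (.inl (.b k))).encard) ∧
        ((2 ^ (n - 1) : ℕ) : ℕ∞) ≤ ((autBMax n d hn).zones σ).encard ∧
        ((2 ^ (n - 1) : ℕ) : ℕ∞) ≤ ((autBMax n d hn).zoneNodes σ).encard) := by
  refine ⟨⟨card_clk n, by rw [Finite.card_option, card_clk], card_loc n hn⟩, fun σ =>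
    ⟨⟨encard_zonesAt_autA hd, encard_zonesAt_autA_b hd, encard_zoneNodes_autA_gadgetV hd,
      encard_zoneNodes_autA hd⟩, ?_, ?_⟩⟩
  -- `N = 1` makes the base `d + 1`; `N = d` below makes it 2.
  · have h := snzWith_autA_blowup (hn := hn) (σ := σ) hd le_rfl hd
    rwa [Nat.div_one] at h
  · have h := snzWith_autA_blowup (hn := hn) (σ := σ) hd hd le_rfl
    rwa [Nat.div_self hd] at h
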